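/- Let $\Bbbk$ be a field of characteristic $0$ and $n\ge 2$. Let $B_n$ be the braid group on $n$ strands with Artin generators $\sigma_1,\dots,\sigma_{n-1}$. Let $\mathcal A_n$ be the unital $\Bbbk$-algebra generated by $t_{ij}=t_{ji}$ ($1\le i\neq j\le n$) with relations $[t_{ij},t_{kl}]=0$ for $i,j,k,l$ distinct and $[t_{jk},t_{ij}+t_{ik}]=0$ for $i,j,k$ distinct, graded by $\deg t_{ij}=1$, and let $\widehat{\mathcal A}_n$ be its completion with respect to the grading. Let $\mathfrak B_n$ and $\widehat{\mathfrak B}_n$ be the crossed products of $\mathcal A_n$ and $\widehat{\mathcal A}_n$ with the symmetric group $\mathfrak S_n$, which acts by $s\cdot t_{ij}=t_{s(i)s(j)}$. Let $\mathcal T_n\subset\mathcal A_n$ be the Lie algebra of primitive elements for the coproduct that makes every $t_{ij}$ primitive, and $\widehat{\mathcal T}_n$ its closure in $\widehat{\mathcal A}_n$. Put $s_i=(i\ \,i{+}1)\in\mathfrak S_n$. A morphism of unital $\Bbbk$-algebras $\varphi:\Bbbk B_n\to\widehat{\mathfrak B}_n$ satisfies (*) if, for every $1\le i\le n-1$, there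 is $\psi_i\in\exp[\widehat{\mathcal T}_n,\widehat{\mathcal T}_n]$ such that $\varphi(\sigma_i)=\psi_i\, s_i\exp(\tfrac12 t_{i,i+1})\,\psi_i^{-1}$. Let $\mathbb L=\Bbbk(q)$ be embedded in $\mathbb K=\Bbbk((h))$ by $q\mapsto\exp(h/2)$. For a representation $\rho:\mathfrak B_n\to\mathrm{End}(\Bbbk^N)$ let $\tilde\rho:\widehat{\mathfrak B}_n\to\mathrm{End}(\mathbb K^N)$ be the ($h$-adically continuous) representation with $\tilde\rho(t_{ij})=h\,\rho(t_{ij})$ and $\tilde\rho(s)=\rho(s)$ for $s\in\mathfrak S_n$, and let $\widehat\varphi(\rho)$ be the representation $\tilde\rho\circ\varphi$ of $B_n$ over $\mathbb K$. For $b\in\Bbbk^\times$ let $b\rho$ be the representation of $\mathfrak B_n$ with $(b\rho)(t_{ij})=b\,\rho(t_{ij})$ and $(b\rho)(s)=\rho(s)$. The infinitesimal Burau representation $\rho_{\mathrm{bur}}$ of $\mathfrak B_n$ on $\Bbbk^n$ is given by $\rho_{\mathrm{bur}}(t_{ij})e_i=e_j$, $\rho_{\mathrm{bur}}(t_{ij})e_j=e_i$,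 $\rho_{\mathrm{bur}}(t_{ij})e_k=e_k$ for $k\notin\{i,j\}$, and $\rho_{\mathrm{bur}}(s)e_i=e_{s(i)}$. The Burau representation $R_{\mathrm{bur}}:B_n\to GL_n(\mathbb L)$ is given by $$R_{\mathrm{bur}}(\sigma_i)=q I_{i-1}\oplus\begin{pmatrix}q-q^{-1}&q\\ q^{-1}&0\end{pmatrix}\oplus qI_{n-i-1},$$ and for $r\in\mathbb Z\setminus\{0\}$ the twisted representation $R_{\mathrm{bur}}^{q^r}$ is obtained by applying the field morphism $\mathbb L\to\mathbb L$, $q\mapsto q^r$, to its matrix entries. Then, for every $\varphi:\Bbbk B_n\to\widehat{\mathfrak B}_n$ satisfying (*), the representation $\widehat\varphi(\rho_{\mathrm{bur}})$ is isomorphic over $\mathbb K$ to the Burau representation $R_{\mathrm{bur}}$ (extended to $\mathbb K$). Moreover, for every $r\in\mathbb Z\setminus\{0\}$, the representation $\widehat\varphi(r\rho_{\mathrm{bur}})$ is isomorphic over $\mathbb K$ to $R_{\mathrm{bur}}^{q^r}$ (extended to $\mathbb K$). -/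

import Mathlib

noncomputable section

namespace InfBraid

/-! ## The braid group -/

/-- The index `i` (1-based: `1 ≤ i ≤ n - 1`) viewed among the `n` strands. -/
def lo {n : ℕ} (i : Fin (n - 1)) : Fin n := ⟨i.1, by omega⟩

/-- The index `i + 1` viewed among the `n` strands. -/
def hi {n : ℕ} (i : Fin (n - 1)) : Fin n := ⟨i.1 + 1, by omega⟩

/-- Artin's relations: `σ_i σ_j = σ_j σ_i` for `|i - j| ≥ 2` and
`σ_i σ_{i+1} σ_i = σ_{i+1} σ_i σ_{i+1}`. -/
inductive ArtinRel (n : ℕ) : FreeGroup (Fin (n - 1)) → Prop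
  | far (i j : Fin (n - 1)) (h : i.1 + 1 < j.1) :
      ArtinRel n (.of i * .of j * (.of j * .of i)⁻¹)
  | braid (i j : Fin (n - 1)) (h : i.1 + 1 = j.1) :
      ArtinRel n (.of i * .of j * .of i * (.of j * .of i * .of j)⁻¹)

/-- The braid group `B_n` on `n` strands, in Artin's presentation. -/
abbrev BraidGroup (n : ℕ) : Type := PresentedGroup {w | ArtinRel n w}

/-- The Artin generator `σ_i`. -/
def artin {n : ℕ} (i : Fin (n - 1)) : BraidGroup n := PresentedGroup.of i

/-! ## The algebra `𝒜_n` of chord diagrams of pure braids -/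

/-- The infinitesimal braid relations between the generators `t_{ij} = t_{ji}`, `i ≠ j`
(the symbol `t_{ii}`, which is not a generator, is set to be `0`). -/
inductive ChordRel (k : Type*) [Field k] (n : ℕ) :
    FreeAlgebra k (Fin n × Fin n) → FreeAlgebra k (Fin n × Fin n) → Prop
  | diag (i : Fin n) : ChordRel k n (.ι k (i, i)) 0
  | symm (i j : Fin n) : ChordRel k n (.ι k (i, j)) (.ι k (j, i))
  | comm (i j l m : Fin n) (hij : i ≠ j) (hil : i ≠ l) (him : i ≠ m) (hjl : j ≠ l)
      (hjm : j ≠ m) (hlm : l ≠ m) :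
      ChordRel k n (.ι k (i, j) * .ι k (l, m)) (.ι k (l, m) * .ι k (i, j))
  | four (i j l : Fin n) (hij : i ≠ j) (hil : i ≠ l) (hjl : j ≠ l) :
      ChordRel k n (.ι k (j, l) * (.ι k (i, j) + .ι k (i, l)))
        ((.ι k (i, j) + .ι k (i, l)) * .ι k (j, l))

/-- The algebra `𝒜_n` of chord diagrams. -/
def ChordAlg (k : Type*) [Field k] (n : ℕ) : Type _ := RingQuot (ChordRel k n)

instance (k : Type*) [Field k] (n : ℕ) : Ring (ChordAlg k n) :=
  inferInstanceAs (Ring (RingQuot (ChordRel k n)))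

instance (k : Type*) [Field k] (n : ℕ) : Algebra k (ChordAlg k n) :=
  inferInstanceAs (Algebra k (RingQuot (ChordRel k n)))

section ChordAlg

variable {k : Type*} [Field k] {n : ℕ}

/-- The generator `t_{ij}` of `𝒜_n`. -/
def chord (k : Type*) [Field k] {n : ℕ} (i j : Fin n) : ChordAlg k n :=
  RingQuot.mkAlgHom k (ChordRel k n) (.ι k (i, j))

/-- A family of elements of an algebra satisfying the infinitesimal braid relations. -/
structure IsChordFamily {E : Type*} [Semiring E] (f : Fin n → Fin n → E) : Prop where
  diag : ∀ i, f i i = 0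
  symm : ∀ i j, f i j = f j i
  comm : ∀ i j l m, i ≠ j → i ≠ l → i ≠ m → j ≠ l → j ≠ m → l ≠ m →
    f i j * f l m = f l m * f i j
  four : ∀ i j l, i ≠ j → i ≠ l → j ≠ l →
    f j l * (f i j + f i l) = (f i j + f i l) * f j l

theorem isChordFamily_chord : IsChordFamily (chord k (n := n)) where
  diag i := by
    have := RingQuot.mkAlgHom_rel k (ChordRel.diag (k := k) i)
    exact this.trans (map_zero _)
  symm i j := RingQuot.mkAlgHom_rel k (ChordRel.symm i j)
  comm i j l m h1 h2 h3 h4 h5 h6 := by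
    have := RingQuot.mkAlgHom_rel k (ChordRel.comm (k := k) i j l m h1 h2 h3 h4 h5 h6)
    rw [map_mul, map_mul] at this
    exact this
  four i j l h1 h2 h3 := by
    have := RingQuot.mkAlgHom_rel k (ChordRel.four (k := k) i j l h1 h2 h3)
    rw [map_mul, map_mul, map_add] at this
    exact this

/-- The universal property of `𝒜_n`. -/
def liftChord {E : Type*} [Semiring E] [Algebra k E] (f : Fin n → Fin n → E)
    (hf : IsChordFamily f) : ChordAlg k n →ₐ[k] E :=
  RingQuot.liftAlgHom k ⟨FreeAlgebra.lift k fun p => f p.1 p.2, by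
    intro x y h
    cases h with
    | diag i => simp [hf.diag]
    | symm i j => simp [hf.symm i j]
    | comm i j l m h1 h2 h3 h4 h5 h6 => simp [hf.comm i j l m h1 h2 h3 h4 h5 h6]
    | four i j l h1 h2 h3 => simp [hf.four i j l h1 h2 h3]⟩

@[simp]
theorem liftChord_chord {E : Type*} [Semiring E] [Algebra k E] (f : Fin n → Fin n → E)
    (hf : IsChordFamily f) (i j : Fin n) : liftChord (k := k) f hf (chord k i j) = f i j := by
  unfold liftChord chord
  exact (RingQuot.liftAlgHom_mkAlgHom_apply k _ _ _).trans (by simp)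

theorem chordAlg_hom_ext {E : Type*} [Semiring E] [Algebra k E] {f g : ChordAlg k n →ₐ[k] E}
    (h : ∀ i j, f (chord k i j) = g (chord k i j)) : f = g := by
  refine RingQuot.ringQuot_ext' k f g ?_
  ext p
  exact h p.1 p.2

theorem chordAlg_induction {p : ChordAlg k n → Prop} (hc : ∀ c, p (algebraMap k _ c))
    (ht : ∀ i j, p (chord k i j)) (hm : ∀ x y, p x → p y → p (x * y))
    (ha : ∀ x y, p x → p y → p (x + y)) (x : ChordAlg k n) : p x := by
  obtain ⟨w, rfl⟩ := RingQuot.mkAlgHom_surjective k (ChordRel k n) x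
  induction w using FreeAlgebra.induction with
  | grade0 c => exact (AlgHom.commutes (RingQuot.mkAlgHom k (ChordRel k n)) c).symm ▸ hc c
  | grade1 q => exact ht q.1 q.2
  | mul u v hu hv => rw [map_mul]; exact hm _ _ hu hv
  | add u v hu hv => rw [map_add]; exact ha _ _ hu hv

theorem IsChordFamily.comp {E : Type*} [Semiring E] {f : Fin n → Fin n → E}
    (hf : IsChordFamily f) (s : Equiv.Perm (Fin n)) :
    IsChordFamily fun i j => f (s i) (s j) where
  diag i := hf.diag _
  symm i j := hf.symm _ _
  comm i j l m h1 h2 h3 h4 h5 h6 := hf.comm _ _ _ _ (by simpa) (by simpa) (by simpa)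
    (by simpa) (by simpa) (by simpa)
  four i j l h1 h2 h3 := hf.four _ _ _ (by simpa) (by simpa) (by simpa)

/-- The action of a permutation on `𝒜_n`: `t_{ij} ↦ t_{s(i) s(j)}`. -/
def permAct (s : Equiv.Perm (Fin n)) : ChordAlg k n →ₐ[k] ChordAlg k n :=
  liftChord (fun i j => chord k (s i) (s j)) (isChordFamily_chord.comp s)

theorem permAct_chord (s : Equiv.Perm (Fin n)) (i j : Fin n) :
    permAct s (chord k i j) = chord k (s i) (s j) := liftChord_chord _ _ i j

theorem permAct_one : permAct (1 : Equiv.Perm (Fin n)) = AlgHom.id k (ChordAlg k n) :=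
  chordAlg_hom_ext fun i j => by simp [permAct_chord]

theorem permAct_mul (s t : Equiv.Perm (Fin n)) :
    permAct (s * t) = (permAct s).comp (permAct (k := k) t) :=
  chordAlg_hom_ext fun i j => by simp [permAct_chord]

instance : MulSemiringAction (Equiv.Perm (Fin n)) (ChordAlg k n) where
  smul s a := permAct s a
  one_smul a := congrArg (fun f : ChordAlg k n →ₐ[k] ChordAlg k n => f a) permAct_one
  mul_smul s t a := congrArg (fun f : ChordAlg k n →ₐ[k] ChordAlg k n => f a) (permAct_mul s t)
  smul_zero s := map_zero (permAct s)
  smul_add s := map_add (permAct s)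
  smul_one s := map_one (permAct s)
  smul_mul s := map_mul (permAct s)

theorem perm_smul_def (s : Equiv.Perm (Fin n)) (a : ChordAlg k n) : s • a = permAct s a := rfl

theorem perm_smul_intertwine {E : Type*} [Semiring E] [Algebra k E] (f : ChordAlg k n →ₐ[k] E)
    (s : Equiv.Perm (Fin n)) (u : E)
    (h : ∀ i j, f (chord k (s i) (s j)) * u = u * f (chord k i j)) (x : ChordAlg k n) :
    f (s • x) * u = u * f x := by
  rw [perm_smul_def]
  induction x using chordAlg_induction with
  | hc c => rw [AlgHom.commutes, AlgHom.commutes]; exact Algebra.commutes c u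
  | ht i j => rw [permAct_chord]; exact h i j
  | hm x y hx hy => rw [map_mul, map_mul, map_mul, mul_assoc, hy, ← mul_assoc, hx, mul_assoc]
  | ha x y hx hy => rw [map_add, map_add, map_add, add_mul, hx, hy, mul_add]

instance : SMulCommClass (Equiv.Perm (Fin n)) k (ChordAlg k n) :=
  ⟨fun s c a => map_smul (permAct s) c a⟩

/-- The component of `𝒜_n` of degree `d`, spanned by the products of `d` chords. -/
def degPart (k : Type*) [Field k] (n d : ℕ) : Submodule k (ChordAlg k n) :=
  Submodule.span k (Set.range fun p : Fin n × Fin n => chord k p.1 p.2) ^ d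

theorem permAct_mem_degPart (s : Equiv.Perm (Fin n)) {d : ℕ} {a : ChordAlg k n}
    (ha : a ∈ degPart k n d) : permAct s a ∈ degPart k n d := by
  have h : (degPart k n d).map (permAct s).toLinearMap ≤ degPart k n d := by
    unfold degPart
    rw [Submodule.map_pow]
    refine pow_le_pow_left' ?_ d
    rw [Submodule.map_span, Submodule.span_le]
    rintro _ ⟨_, ⟨p, rfl⟩, rfl⟩
    exact Submodule.subset_span ⟨(s p.1, s p.2), (permAct_chord s p.1 p.2).symm⟩
  exact h ⟨a, ha, rfl⟩

/-- The coproduct `□` of `𝒜_n`: the generators `t_{ij}` are primitive. -/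
def coprod (k : Type*) [Field k] (n : ℕ) :
    ChordAlg k n →ₐ[k] TensorProduct k (ChordAlg k n) (ChordAlg k n) :=
  liftChord (fun i j => TensorProduct.tmul k (chord k i j) 1 + TensorProduct.tmul k 1 (chord k i j))
    { diag := fun i => by simp [isChordFamily_chord.diag]
      symm := fun i j => by rw [isChordFamily_chord.symm]
      comm := fun i j l m h1 h2 h3 h4 h5 h6 => by
        have := (isChordFamily_chord (k := k)).comm i j l m h1 h2 h3 h4 h5 h6
        simp only [mul_add, add_mul, Algebra.TensorProduct.tmul_mul_tmul, mul_one, one_mul, this]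
        abel
      four := fun i j l h1 h2 h3 => by
        have := (isChordFamily_chord (k := k)).four i j l h1 h2 h3
        have e1 := congrArg (fun x => TensorProduct.tmul k x (1 : ChordAlg k n)) this
        have e2 := congrArg (fun x => TensorProduct.tmul k (1 : ChordAlg k n) x) this
        simp only [mul_add, add_mul, TensorProduct.add_tmul, TensorProduct.tmul_add] at e1 e2
        simp only [mul_add, add_mul, Algebra.TensorProduct.tmul_mul_tmul, mul_one, one_mul]
        linear_combination (norm := abel) e1 + e2 }

/-- The Lie algebra `𝒯_n` of primitive elements of `𝒜_n` (its bracket is the commutator). -/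
def primitives (k : Type*) [Field k] (n : ℕ) : Submodule k (ChordAlg k n) where
  carrier := {x | coprod k n x = TensorProduct.tmul k x 1 + TensorProduct.tmul k 1 x}
  add_mem' {x y} hx hy := by
    simp only [Set.mem_ofPred_eq, map_add, TensorProduct.add_tmul, TensorProduct.tmul_add] at *
    rw [hx, hy]; abel
  zero_mem' := by simp
  smul_mem' c x hx := by
    simp only [Set.mem_ofPred_eq, map_smul, TensorProduct.tmul_smul,
      ← TensorProduct.smul_tmul', ← smul_add] at *
    rw [hx]

end ChordAlg

/-! ## The completion of `𝒜_n` and the crossed products `𝔅_n`, `𝔅̂_n` -/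

/-- The completion `𝒜̂_n` of `𝒜_n` with respect to the grading by the number of chords. An element
is a family `(a_d)_d` with `a_d` of degree `d`, written as the power series `∑ a_d X^d`, so that
the product is the Cauchy product. -/
def completion (k : Type*) [Field k] (n : ℕ) : Subalgebra k (PowerSeries (ChordAlg k n)) where
  carrier := {f | ∀ d, PowerSeries.coeff d f ∈ degPart k n d}
  mul_mem' {f g} hf hg d := by
    rw [PowerSeries.coeff_mul]
    refine Submodule.sum_mem _ fun p hp => ?_
    have h : degPart k n p.1 * degPart k n p.2 = degPart k n d := by
      rw [degPart, degPart, degPart, ← pow_add, Finset.HasAntidiagonal.mem_antidiagonal.mp hp]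
    exact h ▸ Submodule.mul_mem_mul (hf p.1) (hg p.2)
  add_mem' {f g} hf hg d := by
    rw [map_add]; exact add_mem (hf d) (hg d)
  algebraMap_mem' c d := by
    rw [PowerSeries.algebraMap_apply, PowerSeries.coeff_C]
    split_ifs with h
    · subst h
      rw [degPart, pow_zero]
      exact Submodule.algebraMap_mem c
    · exact zero_mem _

/-- The algebra `𝒜̂_n`. -/
abbrev CompChordAlg (k : Type*) [Field k] (n : ℕ) : Type _ := completion k n

section Completion

variable {k : Type*} [Field k] {n : ℕ}

/-- The degree `d` component of an element of `𝒜̂_n`. -/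
def component (d : ℕ) (f : CompChordAlg k n) : ChordAlg k n :=
  PowerSeries.coeff d (f : PowerSeries (ChordAlg k n))

theorem component_ext {f g : CompChordAlg k n} (h : ∀ d, component d f = component d g) : f = g :=
  Subtype.ext (PowerSeries.ext h)

theorem component_mul (d : ℕ) (f g : CompChordAlg k n) :
    component d (f * g) = ∑ p ∈ Finset.HasAntidiagonal.antidiagonal d, component p.1 f * component p.2 g :=
  PowerSeries.coeff_mul d _ _

/-- The element of `𝒜̂_n` with given components. -/
def ofComp (a : ℕ → ChordAlg k n) (ha : ∀ d, a d ∈ degPart k n d) : CompChordAlg k n :=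
  ⟨PowerSeries.mk a, fun d => by rw [PowerSeries.coeff_mk]; exact ha d⟩

@[simp]
theorem component_ofComp (a : ℕ → ChordAlg k n) (ha : ∀ d, a d ∈ degPart k n d) (d : ℕ) :
    component d (ofComp a ha) = a d := PowerSeries.coeff_mk d a

/-- The action of `𝔖_n` on `𝒜̂_n`, degree by degree. -/
instance : SMul (Equiv.Perm (Fin n)) (CompChordAlg k n) where
  smul s f := ofComp (fun d => s • component d f) fun d => permAct_mem_degPart s (f.2 d)

theorem component_smul (s : Equiv.Perm (Fin n)) (f : CompChordAlg k n) (d : ℕ) :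
    component d (s • f) = s • component d f :=
  component_ofComp (fun d => s • component d f) (fun d => permAct_mem_degPart s (f.2 d)) d

theorem component_add (d : ℕ) (f g : CompChordAlg k n) : component d (f + g) = component d f + component d g :=
  map_add (PowerSeries.coeff d) _ _

theorem component_zero (d : ℕ) : component d (0 : CompChordAlg k n) = 0 :=
  map_zero (PowerSeries.coeff d)

theorem component_one (d : ℕ) : component d (1 : CompChordAlg k n) = if d = 0 then 1 else 0 :=
  PowerSeries.coeff_one d

theorem component_const_smul (c : k) (d : ℕ) (f : CompChordAlg k n) : component d (c • f) = c • component d f :=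
  rfl

instance : MulSemiringAction (Equiv.Perm (Fin n)) (CompChordAlg k n) where
  one_smul f := component_ext fun d => by rw [component_smul, one_smul]
  mul_smul s t f := component_ext fun d => by simp only [component_smul, mul_smul]
  smul_zero s := component_ext fun d => by rw [component_smul, component_zero, smul_zero]
  smul_add s f g := component_ext fun d => by simp only [component_smul, component_add, smul_add]
  smul_one s := component_ext fun d => by
    rw [component_smul, component_one]
    split_ifs
    · exact smul_one s
    · exact smul_zero s
  smul_mul s f g := component_ext fun d => by
    simp only [component_smul, component_mul, Finset.smul_sum, MulSemiringAction.smul_mul]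

instance : SMulCommClass (Equiv.Perm (Fin n)) k (CompChordAlg k n) :=
  ⟨fun s c f => component_ext fun d => by
    rw [component_smul, component_const_smul, component_const_smul, component_smul, smul_comm]⟩

theorem chord_mem_degPart (i j : Fin n) : chord k i j ∈ degPart k n 1 := by
  rw [degPart, pow_one]
  exact Submodule.subset_span ⟨(i, j), rfl⟩

/-- The generator `t_{ij}` as an element of `𝒜̂_n`. -/
def compChord (k : Type*) [Field k] {n : ℕ} (i j : Fin n) : CompChordAlg k n :=
  ⟨PowerSeries.monomial 1 (chord k i j), fun d => by
    rw [PowerSeries.coeff_monomial]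
    split_ifs with h
    · subst h; exact chord_mem_degPart i j
    · exact zero_mem _⟩

theorem isChordFamily_compChord : IsChordFamily (compChord k (n := n)) where
  diag i := Subtype.ext <| by simp [compChord, isChordFamily_chord.diag]
  symm i j := Subtype.ext <| by simp only [compChord, isChordFamily_chord.symm i j]
  comm i j l m h1 h2 h3 h4 h5 h6 := Subtype.ext <| by
    change PowerSeries.monomial 1 _ * PowerSeries.monomial 1 _ =
      PowerSeries.monomial 1 _ * PowerSeries.monomial 1 _
    rw [PowerSeries.monomial_mul_monomial, PowerSeries.monomial_mul_monomial,
      isChordFamily_chord.comm i j l m h1 h2 h3 h4 h5 h6]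
  four i j l h1 h2 h3 := Subtype.ext <| by
    change PowerSeries.monomial 1 _ * (PowerSeries.monomial 1 _ + PowerSeries.monomial 1 _) =
      (PowerSeries.monomial 1 _ + PowerSeries.monomial 1 _) * PowerSeries.monomial 1 _
    rw [← map_add, PowerSeries.monomial_mul_monomial, PowerSeries.monomial_mul_monomial,
      isChordFamily_chord.four i j l h1 h2 h3]

/-- The canonical map `𝒜_n → 𝒜̂_n`. -/
def toCompletion (k : Type*) [Field k] (n : ℕ) : ChordAlg k n →ₐ[k] CompChordAlg k n :=
  liftChord (compChord k) isChordFamily_compChord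

/-- The closure `𝒯̂_n` of `𝒯_n` in `𝒜̂_n`: the elements that agree in all degrees `< N`, for every
`N`, with some element of `𝒯_n`. -/
def compPrimitives (k : Type*) [Field k] (n : ℕ) : Submodule k (CompChordAlg k n) where
  carrier := {f | ∀ N : ℕ, ∃ y ∈ primitives k n, ∀ d < N, component d (toCompletion k n y) = component d f}
  add_mem' {f g} hf hg N := by
    obtain ⟨y, hy, hy'⟩ := hf N
    obtain ⟨z, hz, hz'⟩ := hg N
    refine ⟨y + z, add_mem hy hz, fun d hd => ?_⟩
    rw [map_add]
    exact congrArg₂ (· + ·) (hy' d hd) (hz' d hd)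
  zero_mem' N := ⟨0, zero_mem _, fun d _ => by rw [map_zero]⟩
  smul_mem' c f hf N := by
    obtain ⟨y, hy, hy'⟩ := hf N
    refine ⟨c • y, Submodule.smul_mem _ c hy, fun d hd => ?_⟩
    rw [map_smul]
    exact congrArg (c • ·) (hy' d hd)

/-- The derived Lie algebra `[𝒯̂_n, 𝒯̂_n]`, spanned by the commutators. -/
def derivedPrimitives (k : Type*) [Field k] (n : ℕ) : Submodule k (CompChordAlg k n) :=
  Submodule.span k
    {z | ∃ x ∈ compPrimitives k n, ∃ y ∈ compPrimitives k n, z = x * y - y * x}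

/-- The exponential `∑ x ^ m / m!` of an element `x` of `𝒜̂_n` without term of degree `0`. Since
`x ^ m` then has no term of degree `< m`, only `m ≤ d` contribute to the component of degree `d`. -/
def compExp (x : CompChordAlg k n) : CompChordAlg k n :=
  ofComp (fun d => ∑ m ∈ Finset.range (d + 1), ((m.factorial : k)⁻¹) • component d (x ^ m)) fun d =>
    Submodule.sum_mem _ fun m _ => Submodule.smul_mem _ _ ((x ^ m).2 d)

end Completion

/-- The algebra `𝔅_n`, crossed product of `𝒜_n` with `𝔖_n`: it is the free `𝒜_n`-module on
`𝔖_n`, with `(a s) (b t) = (a (s • b)) (s t)`. -/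
abbrev InfBraidAlg (k : Type*) [Field k] (n : ℕ) : Type _ :=
  SkewMonoidAlgebra (ChordAlg k n) (Equiv.Perm (Fin n))

/-- The algebra `𝔅̂_n`, crossed product of `𝒜̂_n` with `𝔖_n`. -/
abbrev CompInfBraidAlg (k : Type*) [Field k] (n : ℕ) : Type _ :=
  SkewMonoidAlgebra (CompChordAlg k n) (Equiv.Perm (Fin n))

/-- The transposition `s_i = (i, i+1)`. -/
def adjSwap {n : ℕ} (i : Fin (n - 1)) : Equiv.Perm (Fin n) := Equiv.swap (lo i) (hi i)

/-- The element `R_i = s_i exp(t_{i,i+1} / 2)` of `𝔅̂_n`. -/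
def elemR (k : Type*) [Field k] {n : ℕ} (i : Fin (n - 1)) : CompInfBraidAlg k n :=
  SkewMonoidAlgebra.single (adjSwap i) 1 *
    SkewMonoidAlgebra.single 1 (compExp ((1 / 2 : k) • compChord k (lo i) (hi i)))

/-- Property `(*)`: for all `i`, `φ(σ_i)` is conjugated to `R_i` by some
`ψ_i ∈ exp [𝒯̂_n, 𝒯̂_n]`. -/
def PropertyStar {k : Type*} [Field k] {n : ℕ}
    (φ : MonoidAlgebra k (BraidGroup n) →ₐ[k] CompInfBraidAlg k n) : Prop :=
  ∀ i : Fin (n - 1), ∃ x ∈ derivedPrimitives k n, ∃ ψ : (CompInfBraidAlg k n)ˣ,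
    (ψ : CompInfBraidAlg k n) = SkewMonoidAlgebra.single 1 (compExp x) ∧
    φ (MonoidAlgebra.of k (BraidGroup n) (artin i)) = ψ * elemR k i * ↑ψ⁻¹

/-! ## Representations of `𝔅_n` and the associated representations of `B_n` -/

section Representations

theorem single_one_mul_single_one {A G : Type*} [Semiring A] [Monoid G] [MulSemiringAction G A]
    (s : G) (a : A) :
    (SkewMonoidAlgebra.single s 1 : SkewMonoidAlgebra A G) * SkewMonoidAlgebra.single 1 a =
      SkewMonoidAlgebra.single 1 (s • a) * SkewMonoidAlgebra.single s 1 := by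
  simp [SkewMonoidAlgebra.single_mul_single]

/-- The embedding `a ↦ a` of `A` into a crossed product. -/
def inclAlg (k A G : Type*) [CommSemiring k] [Semiring A] [Algebra k A] [Monoid G]
    [MulSemiringAction G A] [SMulCommClass G k A] : A →ₐ[k] SkewMonoidAlgebra A G where
  toFun a := SkewMonoidAlgebra.single 1 a
  map_one' := rfl
  map_mul' a b := by simp [SkewMonoidAlgebra.single_mul_single]
  map_zero' := by simp
  map_add' a b := SkewMonoidAlgebra.single_add 1 a b
  commutes' c := rfl

variable {k : Type*} [Field k] {n : ℕ} {ι : Type*} [Fintype ι] [DecidableEq ι]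

/-- The restriction to `𝒜̂_n` of the representation `ρ̃`: on the component of degree `d`, it is
`h ^ d ρ`. -/
def tildeChord (ρ : InfBraidAlg k n →ₐ[k] Matrix ι ι k) :
    CompChordAlg k n →+* Matrix ι ι (LaurentSeries k) where
  toFun f := Matrix.of fun a b => HahnSeries.ofPowerSeries ℤ k
    (PowerSeries.mk fun d => ρ (SkewMonoidAlgebra.single 1 (component d f)) a b)
  map_one' := by
    refine Matrix.ext fun a b => ?_
    rw [Matrix.of_apply]
    have h : (PowerSeries.mk fun d => ρ (SkewMonoidAlgebra.single 1
        (component d (1 : CompChordAlg k n))) a b) = PowerSeries.C ((1 : Matrix ι ι k) a b) := by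
      ext d
      rw [PowerSeries.coeff_mk, component_one, PowerSeries.coeff_C]
      split_ifs
      · rw [SkewMonoidAlgebra.single_one_one, map_one]
      · simp
    rw [h, Matrix.one_apply, Matrix.one_apply]
    split_ifs <;> simp
  map_mul' f g := by
    refine Matrix.ext fun a b => ?_
    rw [Matrix.mul_apply]
    simp only [Matrix.of_apply, ← map_mul, ← map_sum]
    refine congrArg (HahnSeries.ofPowerSeries ℤ k) (PowerSeries.ext fun d => ?_)
    rw [PowerSeries.coeff_mk, component_mul, map_sum]
    simp only [PowerSeries.coeff_mul, PowerSeries.coeff_mk]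
    rw [Finset.sum_comm]
    have h := map_sum (ρ.comp (inclAlg k (ChordAlg k n) (Equiv.Perm (Fin n))))
      (fun p : ℕ × ℕ => component p.1 f * component p.2 g) (Finset.HasAntidiagonal.antidiagonal d)
    have h' := congrFun (congrFun h a) b
    refine h'.trans ?_
    rw [Matrix.sum_apply]
    refine Finset.sum_congr rfl fun p _ => ?_
    rw [map_mul, Matrix.mul_apply]
    rfl
  map_zero' := by
    refine Matrix.ext fun a b => ?_
    simp only [component_zero, SkewMonoidAlgebra.single_zero, map_zero, Matrix.of_apply,
      Matrix.zero_apply]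
    rw [← map_zero (HahnSeries.ofPowerSeries ℤ k)]
    congr 1
  map_add' f g := by
    refine Matrix.ext fun a b => ?_
    simp only [component_add, SkewMonoidAlgebra.single_add, map_add, Matrix.of_apply, Matrix.add_apply]
    rw [← map_add (HahnSeries.ofPowerSeries ℤ k)]
    congr 1

/-- The representation `ρ̃ : 𝔅̂_n → End(K^N)`, `K = k((h))`, associated with a representation
`ρ : 𝔅_n → End(k^N)`: `ρ̃(t_{ij}) = h ρ(t_{ij})` and `ρ̃(s) = ρ(s)` for `s ∈ 𝔖_n`. -/
def tilde (ρ : InfBraidAlg k n →ₐ[k] Matrix ι ι k) :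
    CompInfBraidAlg k n →+* Matrix ι ι (LaurentSeries k) :=
  SkewMonoidAlgebra.liftNCRingHom (tildeChord ρ)
    ((HahnSeries.C : k →+* LaurentSeries k).mapMatrix.toMonoidHom.comp
      ((ρ : InfBraidAlg k n →* Matrix ι ι k).comp (SkewMonoidAlgebra.of _ _)))
    (by
      intro f s
      refine Matrix.ext fun a b => ?_
      have hC : ∀ c : k, (HahnSeries.C c : LaurentSeries k) =
          HahnSeries.ofPowerSeries ℤ k (PowerSeries.C c) := fun c =>
        (HahnSeries.ofPowerSeries_C c).symm
      change ∑ x, HahnSeries.ofPowerSeries ℤ k (PowerSeries.mk fun d =>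
          ρ (SkewMonoidAlgebra.single 1 (component d (s • f))) a x) *
          HahnSeries.C (ρ (SkewMonoidAlgebra.single s 1) x b) =
        ∑ x, HahnSeries.C (ρ (SkewMonoidAlgebra.single s 1) a x) *
          HahnSeries.ofPowerSeries ℤ k (PowerSeries.mk fun d =>
            ρ (SkewMonoidAlgebra.single 1 (component d f)) x b)
      simp only [hC, ← map_mul, ← map_sum]
      refine congrArg (HahnSeries.ofPowerSeries ℤ k) (PowerSeries.ext fun d => ?_)
      simp only [map_sum, PowerSeries.coeff_mul_C, PowerSeries.coeff_C_mul, PowerSeries.coeff_mk,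
        component_smul]
      rw [← Matrix.mul_apply, ← Matrix.mul_apply, ← map_mul, ← map_mul, single_one_mul_single_one])

/-- The `K`-linear representation on `K^N` given by a morphism to matrices. -/
def matRep {G F : Type*} [Monoid G] [Field F] (R : G →* Matrix ι ι F) :
    Representation F G (ι → F) :=
  (Matrix.toLinAlgEquiv' : Matrix ι ι F ≃ₐ[F] _).toAlgHom.toMonoidHom.comp R

/-- The representation `φ̂(ρ) = ρ̃ ∘ φ` of `B_n` over `K = k((h))`. -/
def hatRep (φ : MonoidAlgebra k (BraidGroup n) →ₐ[k] CompInfBraidAlg k n)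
    (ρ : InfBraidAlg k n →ₐ[k] Matrix ι ι k) :
    Representation (LaurentSeries k) (BraidGroup n) (ι → LaurentSeries k) :=
  matRep (((tilde ρ).comp φ.toRingHom).toMonoidHom.comp (MonoidAlgebra.of k (BraidGroup n)))

/-- The endomorphism of `𝔅_n` with `t_{ij} ↦ b t_{ij}` and `s ↦ s` for `s ∈ 𝔖_n`. -/
def scaleAlg (n : ℕ) (b : k) : InfBraidAlg k n →ₐ[k] InfBraidAlg k n :=
  SkewMonoidAlgebra.liftNCAlgHom
    (liftChord (fun i j => SkewMonoidAlgebra.single 1 (b • chord k i j))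
      { diag := fun i => by simp [isChordFamily_chord.diag]
        symm := fun i j => by rw [isChordFamily_chord.symm]
        comm := fun i j l m h1 h2 h3 h4 h5 h6 => by
          simp [SkewMonoidAlgebra.single_mul_single,
            isChordFamily_chord.comm i j l m h1 h2 h3 h4 h5 h6]
        four := fun i j l h1 h2 h3 => by
          simp [SkewMonoidAlgebra.single_mul_single, ← SkewMonoidAlgebra.single_add, ← smul_add,
            isChordFamily_chord.four i j l h1 h2 h3] })
    (SkewMonoidAlgebra.of _ _)
    (by
      intro a s
      refine perm_smul_intertwine _ s _ (fun i j => ?_) a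
      rw [liftChord_chord, liftChord_chord, SkewMonoidAlgebra.of_apply, single_one_mul_single_one,
        smul_comm, perm_smul_def, permAct_chord])

/-- The representation `b ρ` of `𝔅_n`: `(b ρ)(t_{ij}) = b ρ(t_{ij})` and `(b ρ)(s) = ρ(s)`. -/
def scaleRep (b : k) (ρ : InfBraidAlg k n →ₐ[k] Matrix ι ι k) :
    InfBraidAlg k n →ₐ[k] Matrix ι ι k :=
  ρ.comp (scaleAlg n b)

end Representations

/-! ## The infinitesimal Burau representation -/

section InfBurau

variable (k : Type*) [Field k] {n : ℕ}

/-- The permutation representation `s e_i = e_{s(i)}`. -/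
def permRep (n : ℕ) : Equiv.Perm (Fin n) →* Matrix (Fin n) (Fin n) k where
  toFun s := Matrix.of fun a b => if a = s b then 1 else 0
  map_one' := by
    ext a b
    change (if a = b then (1 : k) else 0) = (1 : Matrix (Fin n) (Fin n) k) a b
    rw [Matrix.one_apply]
  map_mul' s t := by
    ext a b
    rw [Matrix.mul_apply]
    change (if a = s (t b) then (1 : k) else 0) =
      ∑ c, (if a = s c then (1 : k) else 0) * (if c = t b then 1 else 0)
    rw [Finset.sum_eq_single (t b)] <;> simp +contextual

/-- `ρ_bur(t_{ij})` exchanges `e_i` and `e_j` and fixes the other `e_k` (for `i ≠ j`). -/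
def infBurauChord (i j : Fin n) : Matrix (Fin n) (Fin n) k :=
  if i = j then 0 else permRep k n (Equiv.swap i j)

theorem permRep_swap_mul (i j : Fin n) (s : Equiv.Perm (Fin n)) :
    infBurauChord k (s i) (s j) * permRep k n s = permRep k n s * infBurauChord k i j := by
  unfold infBurauChord
  by_cases h : i = j
  · simp [h]
  · rw [if_neg h, if_neg (by simpa), ← map_mul, ← map_mul, Equiv.mul_swap_eq_swap_mul]

theorem isChordFamily_infBurau : IsChordFamily (infBurauChord k (n := n)) where
  diag i := by simp [infBurauChord]
  symm i j := by simp only [infBurauChord, eq_comm (a := i), Equiv.swap_comm i]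
  comm i j l m h1 h2 h3 h4 h5 h6 := by
    have := permRep_swap_mul k i j (Equiv.swap l m)
    rw [Equiv.swap_apply_of_ne_of_ne h2 h3, Equiv.swap_apply_of_ne_of_ne h4 h5] at this
    simpa [infBurauChord, h6] using this
  four i j l h1 h2 h3 := by
    have e1 := permRep_swap_mul k i j (Equiv.swap j l)
    have e2 := permRep_swap_mul k i l (Equiv.swap j l)
    rw [Equiv.swap_apply_of_ne_of_ne h1 h2, Equiv.swap_apply_left] at e1
    rw [Equiv.swap_apply_of_ne_of_ne h1 h2, Equiv.swap_apply_right] at e2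
    have e3 : infBurauChord k j l = permRep k n (Equiv.swap j l) := by simp [infBurauChord, h3]
    rw [e3, mul_add, add_mul, ← e1, ← e2, add_comm]

/-- The infinitesimal Burau representation `ρ_bur` of `𝔅_n` on `k^n`:
`ρ_bur(t_{ij})` exchanges `e_i` and `e_j` and fixes `e_l` for `l ∉ {i, j}`, and
`ρ_bur(s) e_i = e_{s(i)}` for `s ∈ 𝔖_n`. -/
def infBurau (n : ℕ) : InfBraidAlg k n →ₐ[k] Matrix (Fin n) (Fin n) k :=
  SkewMonoidAlgebra.liftNCAlgHom (liftChord (infBurauChord k) (isChordFamily_infBurau k))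
    (permRep k n)
    (by
      intro a s
      refine perm_smul_intertwine _ s _ (fun i j => ?_) a
      rw [liftChord_chord, liftChord_chord, permRep_swap_mul])

end InfBurau

/-! ## The Burau representation -/

section Burau

/-- The matrix `q I_{i-1} ⊕ (q - q⁻¹, q; q⁻¹, 0) ⊕ q I_{n-i-1}`. -/
def burauMat {F : Type*} [Field F] {n : ℕ} (q : F) (i : Fin (n - 1)) : Matrix (Fin n) (Fin n) F :=
  Matrix.of fun a b =>
    if a = lo i ∧ b = lo i then q - q⁻¹
    else if a = lo i ∧ b = hi i then q
    else if a = hi i ∧ b = lo i then q⁻¹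
    else if a = hi i ∧ b = hi i then 0
    else if a = b then q else 0

theorem lo_ne_hi {n : ℕ} (i : Fin (n - 1)) : lo i ≠ hi i := fun h => by
  simp [lo, hi, Fin.ext_iff] at h

theorem burauMat_mulVec {F : Type*} [Field F] {n : ℕ} (q : F) (i : Fin (n - 1)) (v : Fin n → F)
    (a : Fin n) : (burauMat q i).mulVec v a =
      if a = lo i then (q - q⁻¹) * v (lo i) + q * v (hi i)
      else if a = hi i then q⁻¹ * v (lo i) else q * v a := by
  have hne := lo_ne_hi i
  rw [Matrix.mulVec_eq_sum, Finset.sum_apply]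
  by_cases h1 : a = lo i
  · subst h1
    rw [← Finset.sum_subset (Finset.subset_univ {lo i, hi i}), Finset.sum_pair hne]
    · simp [burauMat, hne.symm, mul_comm]
    · intro b _ hb
      simp only [Finset.mem_insert, Finset.mem_singleton, not_or] at hb
      simp [burauMat, hb.1, hb.2, Ne.symm hb.1, hne]
  · by_cases h2 : a = hi i
    · subst h2
      rw [Finset.sum_eq_single (lo i)]
      · simp [burauMat, hne.symm, mul_comm]
      · intro b _ hb
        simp only [burauMat]
        by_cases h3 : b = hi i
        · simp [h3, hne.symm]
        · simp [hb, h3, hne.symm, Ne.symm h3]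
      · simp
    · rw [Finset.sum_eq_single a]
      · simp [burauMat, h1, h2]
      · intro b _ hb
        simp [burauMat, h1, h2, Ne.symm hb]
      · simp

theorem mat_ext {F : Type*} [Field F] {n : ℕ} {M N : Matrix (Fin n) (Fin n) F}
    (h : ∀ v a, M.mulVec v a = N.mulVec v a) : M = N :=
  Matrix.toLin'.injective (LinearMap.ext fun v => funext fun a => h v a)

theorem burauMat_quadratic {F : Type*} [Field F] {n : ℕ} {q : F} (hq : q ≠ 0) (i : Fin (n - 1)) :
    burauMat q i * (burauMat q i - (q - q⁻¹) • 1) = 1 := by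
  have hne := lo_ne_hi i
  refine mat_ext fun v a => ?_
  rw [← Matrix.mulVec_mulVec, burauMat_mulVec]
  simp only [Matrix.sub_mulVec, Matrix.smul_mulVec, Matrix.one_mulVec, Pi.sub_apply,
    Pi.smul_apply, smul_eq_mul, burauMat_mulVec]
  split_ifs <;> simp_all <;> field_simp <;> ring

theorem burauMat_far {F : Type*} [Field F] {n : ℕ} (q : F) {i j : Fin (n - 1)}
    (h : i.1 + 1 < j.1) : burauMat q i * burauMat q j = burauMat q j * burauMat q i := by
  have h1 : lo i ≠ lo j := fun h' => by simp [lo, Fin.ext_iff] at h'; omega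
  have h2 : lo i ≠ hi j := fun h' => by simp [lo, hi, Fin.ext_iff] at h'; omega
  have h3 : hi i ≠ lo j := fun h' => by simp [lo, hi, Fin.ext_iff] at h'; omega
  have h4 : hi i ≠ hi j := fun h' => by simp [hi, Fin.ext_iff] at h'; omega
  refine mat_ext fun v a => ?_
  rw [← Matrix.mulVec_mulVec, ← Matrix.mulVec_mulVec]
  simp only [burauMat_mulVec, h1, h2, h3, h4, h1.symm, h2.symm, h3.symm, h4.symm, if_false]
  split_ifs <;> simp_all <;> ring

theorem burauMat_braid {F : Type*} [Field F] {n : ℕ} {q : F} (hq : q ≠ 0) {i j : Fin (n - 1)}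
    (h : i.1 + 1 = j.1) : burauMat q i * burauMat q j * burauMat q i =
      burauMat q j * burauMat q i * burauMat q j := by
  have h1 : hi i = lo j := by simp [lo, hi, h]
  have h2 : lo i ≠ lo j := fun h' => by simp [lo, Fin.ext_iff] at h'; omega
  have h3 : lo i ≠ hi j := fun h' => by simp [lo, hi, Fin.ext_iff] at h'; omega
  have h4 := lo_ne_hi j
  refine mat_ext fun v a => ?_
  rw [← Matrix.mulVec_mulVec, ← Matrix.mulVec_mulVec, ← Matrix.mulVec_mulVec,
    ← Matrix.mulVec_mulVec]
  simp only [burauMat_mulVec, h1, h2, h3, h4, h2.symm, h3.symm, h4.symm, if_false, if_true]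
  split_ifs <;> simp_all <;> field_simp <;> ring

/-- The invertible matrix `R_bur(σ_i)`. -/
def burauGL {F : Type*} [Field F] {n : ℕ} {q : F} (hq : q ≠ 0) (i : Fin (n - 1)) :
    Matrix.GeneralLinearGroup (Fin n) F where
  val := burauMat q i
  inv := burauMat q i - (q - q⁻¹) • 1
  val_inv := burauMat_quadratic hq i
  inv_val := mul_eq_one_comm.mp (burauMat_quadratic hq i)

/-- The Burau representation `R_bur : B_n → GL_n(L)`, `L = k(q)`. -/
def burau (k : Type*) [Field k] (n : ℕ) :
    BraidGroup n →* Matrix.GeneralLinearGroup (Fin n) (RatFunc k) :=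
  PresentedGroup.toGroup (f := burauGL (RatFunc.X_ne_zero (K := k))) (by
    intro w hw
    cases hw with
    | far i j h =>
      simp only [map_mul, map_inv, FreeGroup.lift_apply_of, mul_inv_eq_one]
      exact Units.ext (burauMat_far _ h)
    | braid i j h =>
      simp only [map_mul, map_inv, FreeGroup.lift_apply_of, mul_inv_eq_one]
      exact Units.ext (burauMat_braid RatFunc.X_ne_zero h))

end Burau

/-! ## Twisting, and extension of scalars from `k(q)` to `k((h))` -/

section Scalars

variable {k : Type*} [Field k]

/-- The morphism of fields `k(q) → F` with `q ↦ x` that is the identity on `k`, for `x`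
transcendental over `k`. -/
def substField {F : Type*} [Field F] [Algebra k F] (x : F) (hx : Transcendental k x) :
    RatFunc k →+* F :=
  (IntermediateField.val _).toRingHom.comp
    (RatFunc.algEquivOfTranscendental x hx).toAlgHom.toRingHom

theorem transcendental_X_zpow {r : ℤ} (hr : r ≠ 0) :
    Transcendental k ((RatFunc.X : RatFunc k) ^ r) := by
  intro h
  have key : IsAlgebraic k ((RatFunc.X : RatFunc k) ^ r.natAbs) := by
    rcases Int.natAbs_eq r with h' | h'
    · rw [h', zpow_natCast] at h
      simpa using h
    · rw [h', zpow_neg, zpow_natCast] at h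
      simpa using h.inv
  exact RatFunc.transcendental_X (IsAlgebraic.of_pow (Int.natAbs_pos.mpr hr) key)

/-- The field morphism `q ↦ q ^ r` of `L = k(q)`, for `r ≠ 0`. -/
def twistField (k : Type*) [Field k] {r : ℤ} (hr : r ≠ 0) : RatFunc k →+* RatFunc k :=
  substField (RatFunc.X ^ r) (transcendental_X_zpow hr)

/-- The representation `R ^ {q ^ r}` obtained from `R : B_n → GL_N(L)` by twisting by
`q ↦ q ^ r`. -/
def twist {n N : ℕ} {r : ℤ} (hr : r ≠ 0)
    (R : BraidGroup n →* Matrix.GeneralLinearGroup (Fin N) (RatFunc k)) :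
    BraidGroup n →* Matrix.GeneralLinearGroup (Fin N) (RatFunc k) :=
  (Matrix.GeneralLinearGroup.map (twistField k hr)).comp R

/-- The element `exp(h / 2)` of `K = k((h))`. -/
def expHalf (k : Type*) [Field k] : LaurentSeries k :=
  HahnSeries.ofPowerSeries ℤ k (PowerSeries.mk fun d => (1 / 2 : k) ^ d * ((d.factorial : k)⁻¹))

theorem transcendental_expHalf [CharZero k] : Transcendental k (expHalf k) := by
  rw [transcendental_iff]
  intro p hp
  by_contra hp0
  set e : PowerSeries k :=
    PowerSeries.mk fun d => (1 / 2 : k) ^ d * ((d.factorial : k)⁻¹) with he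
  have hpe : p.eval₂ (algebraMap k (PowerSeries k)) e = 0 := by
    apply HahnSeries.ofPowerSeries_injective (Γ := ℤ)
    rw [Polynomial.hom_eval₂, map_zero]
    exact hp
  obtain ⟨g, hg, hdvd⟩ := Polynomial.exists_eq_pow_rootMultiplicity_mul_and_not_dvd p hp0 1
  rw [hg, Polynomial.eval₂_mul, Polynomial.eval₂_pow] at hpe
  rcases mul_eq_zero.mp hpe with h | h
  · have h' := congrArg (PowerSeries.coeff 1) (eq_zero_of_pow_eq_zero h)
    simp [he] at h'
  · have h' := congrArg PowerSeries.constantCoeff h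
    rw [Polynomial.hom_eval₂, map_zero] at h'
    have h1 : PowerSeries.constantCoeff e = 1 := by
      rw [← PowerSeries.coeff_zero_eq_constantCoeff_apply, he, PowerSeries.coeff_mk]; simp
    have h2 : (PowerSeries.constantCoeff (R := k)).comp (algebraMap k (PowerSeries k)) =
        RingHom.id k := by
      ext c; simp
    rw [h1, h2] at h'
    exact hdvd (Polynomial.dvd_iff_isRoot.mpr h')

/-- The embedding of `L = k(q)` in `K = k((h))`, `q ↦ exp(h / 2)`. -/
def embField (k : Type*) [Field k] [CharZero k] : RatFunc k →+* LaurentSeries k :=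
  substField (expHalf k) transcendental_expHalf

/-- The extension to `K` of a representation of `B_n` over `L`. -/
def extendRep [CharZero k] {n N : ℕ}
    (R : BraidGroup n →* Matrix.GeneralLinearGroup (Fin N) (RatFunc k)) :
    Representation (LaurentSeries k) (BraidGroup n) (Fin N → LaurentSeries k) :=
  matRep ((Units.coeHom _).comp ((Matrix.GeneralLinearGroup.map (embField k)).comp R))

end Scalars

end InfBraid

end

noncomputable section

namespace InfBraid

open Matrix

/-! ## Rank one perturbations of scalar matrices satisfying the braid relations -/

section RankOne

variable {K N : Type*} [Field K] [Fintype N]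

/-! Fix b ≠ 0 and put q = exp(bh/2). In bρ_bur the chord t_{i,i+1} acts as b times the transposition
matrix P of s_i, so s_i exp(t_{i,i+1}/2) acts as P(cosh(bh/2) + sinh(bh/2) P) = q − cosh(bh/2)(1 −
P). Since 1 − P has rank one and trace 2, this is q − u vᵀ with v·u = q + q⁻¹. Conjugation by ψ_i
preserves this shape (`tilde_elemR`, `PropertyStar.isReflectionRep`). The Burau matrices have the
same shape with the same q (`burauMat_eq`). It therefore suffices to show that representations of
B_n of this kind are determined by q.

Write σ_i ↦ q − u_i v_iᵀ, and assume that these matrices are pairwise distinct. Commutation of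
distant generators forces v_i·u_j = 0, and the braid relation forces (v_i·u_{i+1})(v_{i+1}·u_i) = 1.
Rescaling the pairs (u_i, v_i) then turns the Gram matrix v_i·u_j into a fixed tridiagonal matrix
depending only on q (`IsReflectionRep.exists_gram`). This matrix is invertible as soon as q^{2n} ≠ 1
(`triGram_mulVec_injective`). The space is then the sum of the span of the u_i and the common kernel
of the v_i, on which B_n acts through scalars. Two such systems with the same Gram matrix, in spaces
of the same dimension, are matched by a linear isomorphism (`exists_intertwiner`).

Distinctness is checked modulo h: exponentials have constant term 1, so the image of σ_i reduces to
the permutation matrix of s_i (`PropertyStar.exists_constantCoeff`). About the ψ_i, nothing more is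
needed than invertibility and constant term 1, which is why the result does not depend on φ. -/

theorem vecMulVec_mul_vecMulVec_eq_smul (u v u' v' : N → K) :
    vecMulVec u v * vecMulVec u' v' = (v ⬝ᵥ u') • vecMulVec u v' := by
  rw [vecMulVec_mul_vecMulVec, vecMulVec_smul]

theorem vecMulVec_mul_mul_self (u v u' v' : N → K) :
    vecMulVec u v * vecMulVec u' v' * vecMulVec u v =
      ((v ⬝ᵥ u') * (v' ⬝ᵥ u)) • vecMulVec u v := by
  rw [vecMulVec_mul_vecMulVec_eq_smul, smul_mul_assoc, vecMulVec_mul_vecMulVec_eq_smul, smul_smul]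

/-- Two distinct commuting rank one matrices with the same nonzero trace annihilate each other. -/
theorem dotProduct_eq_zero_of_commute {u v u' v' : N → K} {δ : K} (hδ : δ ≠ 0)
    (h : v ⬝ᵥ u = δ) (h' : v' ⬝ᵥ u' = δ) (hne : vecMulVec u v ≠ vecMulVec u' v')
    (hc : vecMulVec u v * vecMulVec u' v' = vecMulVec u' v' * vecMulVec u v) :
    v ⬝ᵥ u' = 0 := by
  have h1 := vecMulVec_mul_mul_self u v u' v'
  have h2 := vecMulVec_mul_mul_self u' v' u v
  rw [hc, mul_assoc, vecMulVec_mul_vecMulVec_eq_smul u v u v, h, mul_smul_comm] at h1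
  rw [← hc, mul_assoc, vecMulVec_mul_vecMulVec_eq_smul u' v' u' v', h', mul_smul_comm, hc, h1,
    mul_comm (v' ⬝ᵥ u)] at h2
  -- Write e, e' for the two matrices and c for the product of the two pairings. By commutation, e
  -- e' e = δ e' e and e' e e' = δ e' e, while the rank one identities give c e and c e'. Hence c e
  -- = c e' with e ≠ e'.
  have hab : (v ⬝ᵥ u') * (v' ⬝ᵥ u) = 0 := by
    by_contra hab
    exact hne (smul_right_injective _ hab h2)
  rcases mul_eq_zero.mp hab with ha | hb
  · exact ha
  · rw [vecMulVec_mul_vecMulVec_eq_smul u', hb, zero_smul, vecMulVec_mul_vecMulVec_eq_smul,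
      smul_eq_zero, vecMulVec_eq_zero] at hc
    rcases hc with ha | rfl | rfl
    · exact ha
    · exact absurd (by simpa using h.symm) hδ
    · exact absurd (by simpa using h'.symm) hδ

variable [DecidableEq N]

theorem dotProduct_eq_zero_of_far {u v u' v' : N → K} {q δ : K} (hδ : δ ≠ 0)
    (h : v ⬝ᵥ u = δ) (h' : v' ⬝ᵥ u' = δ)
    (hne : q • 1 - vecMulVec u v ≠ q • 1 - vecMulVec u' v')
    (hc : (q • 1 - vecMulVec u v) * (q • 1 - vecMulVec u' v') =
      (q • 1 - vecMulVec u' v') * (q • 1 - vecMulVec u v)) :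
    v ⬝ᵥ u' = 0 := by
  refine dotProduct_eq_zero_of_commute hδ h h' (fun h => hne (by rw [h])) ?_
  simp only [mul_sub, sub_mul, smul_mul_assoc, mul_smul_comm, one_mul, mul_one] at hc
  linear_combination (norm := module) hc

/-- With e = u vᵀ, e' = u' v'ᵀ and c the product of the pairings, one has e² = (q + q⁻¹)e and e e' e
= c e, and likewise with the roles exchanged. The mixed terms of degree two cancel between the two
sides of the braid relation, leaving (q(q + q⁻¹) − q² − c)(e − e') = (1 − c)(e − e') = 0. -/
theorem dotProduct_mul_dotProduct_of_braid {u v u' v' : N → K} {q : K} (hq : q ≠ 0)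
    (h : v ⬝ᵥ u = q + q⁻¹) (h' : v' ⬝ᵥ u' = q + q⁻¹)
    (hne : q • 1 - vecMulVec u v ≠ q • 1 - vecMulVec u' v')
    (hb : (q • 1 - vecMulVec u v) * (q • 1 - vecMulVec u' v') * (q • 1 - vecMulVec u v) =
      (q • 1 - vecMulVec u' v') * (q • 1 - vecMulVec u v) * (q • 1 - vecMulVec u' v')) :
    (v ⬝ᵥ u') * (v' ⬝ᵥ u) = 1 := by
  have h1 := vecMulVec_mul_mul_self u v u' v'
  have h2 := vecMulVec_mul_mul_self u' v' u v
  have h3 := vecMulVec_mul_vecMulVec_eq_smul u v u v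
  have h4 := vecMulVec_mul_vecMulVec_eq_smul u' v' u' v'
  rw [h] at h3
  rw [h'] at h4
  rw [mul_comm (v' ⬝ᵥ u)] at h2
  have hne' : vecMulVec u v ≠ vecMulVec u' v' := fun h => hne (by rw [h])
  generalize vecMulVec u v = e at *
  generalize vecMulVec u' v' = e' at *
  generalize (v ⬝ᵥ u') * (v' ⬝ᵥ u) = c at *
  simp only [mul_sub, sub_mul, smul_mul_assoc, mul_smul_comm, one_mul, mul_one, h1, h2, h3, h4]
    at hb
  have key : (1 - c) • e = (1 - c) • e' := by
    have k1 : (q * q⁻¹) • e = e := by rw [mul_inv_cancel₀ hq, one_smul]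
    have k2 : (q * q⁻¹) • e' = e' := by rw [mul_inv_cancel₀ hq, one_smul]
    linear_combination (norm := module) hb - k1 + k2
  by_contra hc
  exact hne' (smul_right_injective _ (sub_ne_zero.mpr (Ne.symm hc)) key)

end RankOne

/-! ## The tridiagonal Gram matrix -/

section Gram

variable {K : Type*} [Field K]

/-- The tridiagonal matrix with diagonal entries `q + q⁻¹` and off-diagonal entries `1`. -/
def triGram (q : K) (m : ℕ) : Matrix (Fin m) (Fin m) K :=
  Matrix.of fun i j => if i = j then q + q⁻¹ else if i.1 + 1 = j.1 ∨ j.1 + 1 = i.1 then 1 else 0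

/-- The characteristic roots of the recurrence are −q and −q⁻¹, so a solution vanishing at 0 is a
multiple of (−1)^{j+1}(q^j − q^{−j}). The factor q − q⁻¹ stays on the left so that no case q² = 1
has to be excluded. -/
theorem chebyshev_recurrence {q : K} (hq : q ≠ 0) {m : ℕ} {c : ℕ → K} (h0 : c 0 = 0)
    (h : ∀ j < m, c (j + 2) = -(q + q⁻¹) * c (j + 1) - c j) {j : ℕ} (hj : j ≤ m + 1) :
    (q - q⁻¹) * c j = (-1) ^ (j + 1) * (q ^ j - q⁻¹ ^ j) * c 1 := by
  induction j using Nat.strong_induction_on with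
  | _ j ih =>
    match j with
    | 0 => simp [h0]
    | 1 => simp
    | j + 2 =>
      rw [h j (by omega)]
      have e1 := ih (j + 1) (by omega) (by omega)
      have e2 := ih j (by omega) (by omega)
      have e3 : q * q⁻¹ = 1 := mul_inv_cancel₀ hq
      -- Only q p = 1 matters from here on, so the goal becomes a polynomial identity modulo this
      -- relation.
      generalize q⁻¹ = p at *
      have e4 : (-1 : K) ^ (j + 2 + 1) = -(-1) ^ j := by ring
      have e5 : (-1 : K) ^ (j + 1 + 1) = (-1) ^ j := by ring
      have e6 : (-1 : K) ^ (j + 1) = -(-1) ^ j := by ring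
      have e7 : q ^ (j + 1) * p = q ^ j := by linear_combination q ^ j * e3
      have e8 : p ^ (j + 1) * q = p ^ j := by linear_combination p ^ j * e3
      rw [e5] at e1
      rw [e6] at e2
      rw [e4]
      linear_combination (-(q + p)) * e1 - e2 - (-1) ^ j * c 1 * e7 + (-1) ^ j * c 1 * e8

theorem triGram_mulVec (q : K) {m : ℕ} (c : Fin m → K) (i : Fin m) :
    (triGram q m *ᵥ c) i = (q + q⁻¹) * c i + (if h : i.1 + 1 < m then c ⟨i.1 + 1, h⟩ else 0) +
      (if h : 0 < i.1 then c ⟨i.1 - 1, by omega⟩ else 0) := by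
  have e : ∀ j, triGram q m i j * c j = (if j = i then (q + q⁻¹) * c j else 0) +
      (if i.1 + 1 = j.1 then c j else 0) + (if j.1 + 1 = i.1 then c j else 0) := by
    intro j
    simp only [triGram, Matrix.of_apply, Fin.ext_iff]
    split_ifs <;> first | omega | simp
  rw [Matrix.mulVec, dotProduct]
  simp only [e, Finset.sum_add_distrib, Finset.sum_ite_eq', Finset.mem_univ, if_true]
  congr 1
  · congr 1
    split_ifs with h
    · rw [Finset.sum_eq_single ⟨i.1 + 1, h⟩]
      · exact if_pos rfl
      · intro j _ hj
        simp only [ne_eq, Fin.ext_iff] at hj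
        exact if_neg (by omega)
      · simp
    · exact Finset.sum_eq_zero fun j _ => if_neg (by omega)
  · split_ifs with h
    · rw [Finset.sum_eq_single ⟨i.1 - 1, by omega⟩]
      · exact if_pos (by simp; omega)
      · intro j _ hj
        simp only [ne_eq, Fin.ext_iff] at hj
        exact if_neg (by omega)
      · simp
    · exact Finset.sum_eq_zero fun j _ => if_neg (by omega)

/-- A kernel vector, padded by zeros at both ends, satisfies the recurrence of
`chebyshev_recurrence`. The zero at the far end gives (q^{m+1} − q^{−(m+1)}) d₁ = 0, hence d₁ = 0,
and then everything vanishes. -/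
theorem triGram_mulVec_injective {q : K} (hq : q ≠ 0) {m : ℕ} (hm : q ^ (2 * (m + 1)) ≠ 1) :
    Function.Injective (triGram q m).mulVec := by
  refine (injective_iff_map_eq_zero (Matrix.mulVecLin (triGram q m))).mpr fun c hc => ?_
  -- The indices are shifted to 1, …, m. The default value 0 at 0 and at m + 1 makes the first and
  -- last rows of the matrix instances of the same recurrence.
  set d : ℕ → K := fun j => if h : 0 < j ∧ j ≤ m then c ⟨j - 1, by omega⟩ else 0 with hd
  have hrec : ∀ j < m, d (j + 2) = -(q + q⁻¹) * d (j + 1) - d j := by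
    intro j hj
    have h := congrFun hc ⟨j, hj⟩
    rw [Matrix.mulVecLin_apply, triGram_mulVec] at h
    have e1 : d (j + 1) = c ⟨j, hj⟩ := by simp [hd, hj]
    have e2 : d (j + 2) = if h : j + 1 < m then c ⟨j + 1, h⟩ else 0 := by
      simp [hd, Nat.succ_le_iff]
    have e3 : d j = if h : 0 < j then c ⟨j - 1, by omega⟩ else 0 := by
      simp [hd, hj.le]
    rw [e1, e2, e3]
    simp only [Pi.zero_apply] at h
    linear_combination h
  have hcheb := fun {j} => chebyshev_recurrence hq (m := m) (c := d) (by simp [hd]) hrec (j := j)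
  have hp : ∀ r : ℕ, q ^ (2 * r) ≠ 1 → q ^ r - q⁻¹ ^ r ≠ 0 := by
    intro r hr h
    refine hr ?_
    rw [sub_eq_zero, inv_pow] at h
    rw [two_mul, pow_add]
    nth_rewrite 2 [h]
    exact mul_inv_cancel₀ (pow_ne_zero _ hq)
  -- If q² were 1, then q^{2(m+1)} would be 1 as well.
  have hq1 : q - q⁻¹ ≠ 0 := by
    have := hp 1 (fun h => hm (by rw [pow_mul, show q ^ 2 = 1 by simpa using h, one_pow]))
    simpa using this
  have hd1 : d 1 = 0 := by
    have h := hcheb le_rfl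
    have h0 : d (m + 1) = 0 := by simp [hd]
    rw [h0, mul_zero] at h
    have h' := hp (m + 1) hm
    simpa only [mul_assoc, mul_eq_zero, pow_eq_zero_iff', neg_eq_zero, one_ne_zero, h', false_and,
      false_or] using h.symm
  funext i
  have h := hcheb (j := i.1 + 1) (by omega)
  rw [hd1, mul_zero] at h
  have h' := (mul_eq_zero.mp h).resolve_left hq1
  simpa [hd, Nat.succ_le_iff] using h'

end Gram

/-! ## Comparison of two systems with the same Gram matrix -/

section Intertwiner

variable {K E E' W : Type*} [Field K] [AddCommGroup E] [Module K E] [AddCommGroup E'] [Module K E']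
  [AddCommGroup W] [Module K W]

/-- The splitting of `E` defined by a linear map `V : E → W` and a section of it. -/
def splitEquiv (V : E →ₗ[K] W) (S : W →ₗ[K] E) (h : ∀ w, V (S w) = w) :
    E ≃ₗ[K] W × LinearMap.ker V where
  toFun x := (V x, ⟨x - S (V x), by simp [h]⟩)
  map_add' x y := by ext <;> simp; abel
  map_smul' c x := by ext <;> simp [smul_sub]
  invFun p := S p.1 + p.2
  left_inv x := by simp
  right_inv p := by
    have := p.2.2
    ext <;> simp_all

/-- Since G = VU is bijective, UG⁻¹ is a section of V and E = U(W) ⊕ ker V; similarly for E'. In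
these splittings, P is the identity on W together with any isomorphism ker V ≅ ker V', which exists
because the dimensions agree. The choice is harmless: the matrices q − u_i v_iᵀ act on the common
kernel of the v_i as the scalar q. -/
theorem exists_intertwiner [FiniteDimensional K E] [FiniteDimensional K E']
    [FiniteDimensional K W] (V : E →ₗ[K] W) (U : W →ₗ[K] E) (V' : E' →ₗ[K] W) (U' : W →ₗ[K] E')
    (hrank : Module.finrank K E = Module.finrank K E') (hG : V ∘ₗ U = V' ∘ₗ U')
    (hinj : Function.Injective (V ∘ₗ U)) :
    ∃ P : E ≃ₗ[K] E', (∀ x, V' (P x) = V x) ∧ ∀ w, P (U w) = U' w := by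
  set G := LinearEquiv.ofInjectiveEndo (V ∘ₗ U) hinj with hGdef
  have hGa : ∀ w, G w = V (U w) := fun w => rfl
  have hGa' : ∀ w, G w = V' (U' w) := fun w => LinearMap.congr_fun hG w
  have h : ∀ w, V ((U ∘ₗ G.symm.toLinearMap) w) = w := fun w => by
    simp [← hGa]
  have h' : ∀ w, V' ((U' ∘ₗ G.symm.toLinearMap) w) = w := fun w => by
    simp [← hGa']
  set Θ := splitEquiv V _ h
  set Θ' := splitEquiv V' _ h'
  have hker : Module.finrank K (LinearMap.ker V) = Module.finrank K (LinearMap.ker V') := by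
    have e1 := Θ.finrank_eq
    have e2 := Θ'.finrank_eq
    rw [Module.finrank_prod] at e1 e2
    omega
  set e := LinearEquiv.ofFinrankEq _ _ hker
  refine ⟨Θ.trans (((LinearEquiv.refl K W).prodCongr e).trans Θ'.symm), fun x => ?_, fun w => ?_⟩
  · have h1 : ∀ p, V' (Θ'.symm p) = p.1 := fun p => by
      have := congrArg Prod.fst (Θ'.apply_symm_apply p)
      exact this
    simp only [LinearEquiv.trans_apply, h1]
    rfl
  · have h1 : Θ (U w) = (G w, 0) := by
      refine Prod.ext rfl (Subtype.ext ?_)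
      change U w - U (G.symm (V (U w))) = 0
      rw [← hGa, LinearEquiv.symm_apply_apply, sub_self]
    have h2 : Θ' (U' w) = (G w, 0) := by
      refine Prod.ext (hGa' w).symm (Subtype.ext ?_)
      change U' w - U' (G.symm (V' (U' w))) = 0
      rw [← hGa', LinearEquiv.symm_apply_apply, sub_self]
    simp only [LinearEquiv.trans_apply, h1]
    rw [LinearEquiv.symm_apply_eq, h2]
    simp

end Intertwiner

/-! ## Representations of the braid group by rank one perturbations of scalars -/

section Classification

variable {K : Type*} [Field K] {n : ℕ} {N : Type*} [Fintype N] [DecidableEq N]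

theorem artin_far {i j : Fin (n - 1)} (h : i.1 + 1 < j.1) :
    artin i * artin j = artin j * artin i := by
  have := PresentedGroup.one_of_mem (rels := {w | ArtinRel n w}) (ArtinRel.far i j h)
  rw [map_mul, map_inv, mul_inv_eq_one] at this
  exact this

theorem artin_braid {i j : Fin (n - 1)} (h : i.1 + 1 = j.1) :
    artin i * artin j * artin i = artin j * artin i * artin j := by
  have := PresentedGroup.one_of_mem (rels := {w | ArtinRel n w}) (ArtinRel.braid i j h)
  rw [map_mul, map_inv, mul_inv_eq_one] at this
  exact this

/-- A representation of the braid group in which the Artin generators act by pairwise distinct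
matrices `q - u vᵀ` with `v ⬝ u = q + q⁻¹`. -/
structure IsReflectionRep (q : K) (R : BraidGroup n →* Matrix N N K) : Prop where
  injective : Function.Injective fun i : Fin (n - 1) => R (artin i)
  rankOne : ∀ i : Fin (n - 1), ∃ u v : N → K,
    R (artin i) = q • 1 - vecMulVec u v ∧ v ⬝ᵥ u = q + q⁻¹

/-- The matrix u_i v_iᵀ determines (u_i, v_i) only up to (λ⁻¹u_i, λv_i). This freedom suffices to
make all superdiagonal pairings equal to 1, because the Coxeter graph is a path; the subdiagonal
ones are then 1 by the braid relation. -/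
theorem IsReflectionRep.exists_gram {q : K} {R : BraidGroup n →* Matrix N N K}
    (hR : IsReflectionRep q R) (hq : q ≠ 0) (hq' : q + q⁻¹ ≠ 0) :
    ∃ u v : Fin (n - 1) → N → K, (∀ i, R (artin i) = q • 1 - vecMulVec (u i) (v i)) ∧
      ∀ i j, v i ⬝ᵥ u j = triGram q (n - 1) i j := by
  choose u v hA hδ using hR.rankOne
  have hne : ∀ {i j : Fin (n - 1)}, i ≠ j →
      q • 1 - vecMulVec (u i) (v i) ≠ q • 1 - vecMulVec (u j) (v j) := by
    intro i j hij h
    rw [← hA, ← hA] at h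
    exact hij (hR.injective h)
  have hfar : ∀ {i j : Fin (n - 1)}, i.1 + 1 < j.1 → v i ⬝ᵥ u j = 0 ∧ v j ⬝ᵥ u i = 0 := by
    intro i j h
    have hij : i ≠ j := fun h' => by rw [h'] at h; omega
    have e := congrArg R (artin_far h)
    rw [map_mul, map_mul, hA, hA] at e
    exact ⟨dotProduct_eq_zero_of_far hq' (hδ i) (hδ j) (hne hij) e,
      dotProduct_eq_zero_of_far hq' (hδ j) (hδ i) (hne hij.symm) e.symm⟩
  have hadj : ∀ {i j : Fin (n - 1)}, i.1 + 1 = j.1 → (v i ⬝ᵥ u j) * (v j ⬝ᵥ u i) = 1 := by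
    intro i j h
    have hij : i ≠ j := fun h' => by rw [h'] at h; omega
    have e := congrArg R (artin_braid h)
    simp only [map_mul, hA] at e
    exact dotProduct_mul_dotProduct_of_braid hq (hδ i) (hδ j) (hne hij) e
  -- The superdiagonal pairings v_j·u_{j+1}. The default value 1 past the end keeps every a_j
  -- nonzero, hence also their products.
  set a : ℕ → K := fun j => if h : j + 1 < n - 1 then
    v ⟨j, by omega⟩ ⬝ᵥ u ⟨j + 1, h⟩ else 1 with ha
  have ha0 : ∀ j, a j ≠ 0 := by
    intro j
    simp only [ha]
    split_ifs with h
    · exact left_ne_zero_of_mul_eq_one (hadj (i := ⟨j, by omega⟩) (j := ⟨j + 1, h⟩) rfl)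
    · exact one_ne_zero
  -- The scale factors solve c_{i+1} = c_i a_i, which is the condition c_i c_{i+1}⁻¹ (v_i·u_{i+1}) =
  -- 1.
  set c : ℕ → K := fun i => ∏ j ∈ Finset.range i, a j with hc
  have hc0 : ∀ i, c i ≠ 0 := fun i => Finset.prod_ne_zero_iff.mpr fun j _ => ha0 j
  have hcs : ∀ i, c (i + 1) = c i * a i := fun i => Finset.prod_range_succ _ _
  refine ⟨fun i => (c i)⁻¹ • u i, fun i => c i • v i, fun i => ?_, fun i j => ?_⟩
  · rw [hA, vecMulVec_smul, smul_vecMulVec, smul_smul, mul_inv_cancel₀ (hc0 i), one_smul]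
  · rw [smul_dotProduct, dotProduct_smul, smul_eq_mul, smul_eq_mul, triGram, Matrix.of_apply]
    have haij : ∀ {i j : Fin (n - 1)}, i.1 + 1 = j.1 → a i.1 = v i ⬝ᵥ u j := by
      intro i j h
      have h1 : i.1 + 1 < n - 1 := h ▸ j.2
      have h2 : j = ⟨i.1 + 1, h1⟩ := Fin.ext h.symm
      subst h2
      simp [ha, h1]
    split_ifs with h1 h2
    · subst h1
      rw [hδ, ← mul_assoc, mul_inv_cancel₀ (hc0 i), one_mul]
    · rcases h2 with h2 | h2
      · rw [← h2, hcs, haij h2, ← mul_assoc, ← haij h2]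
        field_simp [hc0 i, ha0 i]
      · have := hadj h2
        rw [← h2, hcs, haij h2]
        have := hc0 j
        field_simp
        linear_combination hadj h2
    · have h3 : i.1 ≠ j.1 := fun h => h1 (Fin.ext h)
      have h4 : v i ⬝ᵥ u j = 0 := by
        rcases Nat.lt_or_ge i.1 j.1 with h | h
        · exact (hfar (i := i) (j := j) (by omega)).1
        · exact (hfar (i := j) (j := i) (by omega)).2
      rw [h4, mul_zero, mul_zero]

/-- A reflection representation of the braid group is determined by its parameter. -/
theorem IsReflectionRep.nonempty_equiv {q : K} {R S : BraidGroup n →* Matrix N N K}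
    (hR : IsReflectionRep q R) (hS : IsReflectionRep q S) (hq : q ≠ 0) (hq' : q + q⁻¹ ≠ 0)
    (hqn : q ^ (2 * (n - 1 + 1)) ≠ 1) :
    Nonempty (Representation.Equiv (matRep R) (matRep S)) := by
  obtain ⟨u, v, hA, hG⟩ := hR.exists_gram hq hq'
  obtain ⟨u', v', hA', hG'⟩ := hS.exists_gram hq hq'
  -- The v_i are the rows of V and the u_j the columns of U, so VU is the Gram matrix.
  have hVU : ∀ {u v : Fin (n - 1) → N → K}, (∀ i j, v i ⬝ᵥ u j = triGram q (n - 1) i j) →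
      (Matrix.of v).mulVecLin ∘ₗ (Matrix.of u)ᵀ.mulVecLin = (triGram q (n - 1)).mulVecLin := by
    intro u v h
    rw [← Matrix.mulVecLin_mul]
    congr 1
    ext i j
    rw [← h, Matrix.mul_apply]
    rfl
  obtain ⟨P, hPV, hPU⟩ := exists_intertwiner (Matrix.of v).mulVecLin (Matrix.of u)ᵀ.mulVecLin
    (Matrix.of v').mulVecLin (Matrix.of u')ᵀ.mulVecLin rfl ((hVU hG).trans (hVU hG').symm)
    (by rw [hVU hG]; exact triGram_mulVec_injective hq hqn)
  have hPu : ∀ i, P (u i) = u' i := by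
    intro i
    have := hPU (Pi.single i 1)
    simpa [Matrix.mulVec_single_one, Matrix.col] using this
  have hPv : ∀ i x, v' i ⬝ᵥ P x = v i ⬝ᵥ x := fun i x => congrFun (hPV x) i
  -- P carries u_i to u'_i and the form v_i to v'_i, so it carries q − u_i v_iᵀ to q − u'_i v'_iᵀ.
  have hgen : ∀ i x, P (R (artin i) *ᵥ x) = S (artin i) *ᵥ P x := by
    intro i x
    rw [hA, hA', Matrix.sub_mulVec, Matrix.sub_mulVec, Matrix.smul_mulVec, Matrix.smul_mulVec,
      Matrix.one_mulVec, Matrix.one_mulVec, vecMulVec_mulVec, vecMulVec_mulVec, map_sub, map_smul,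
      op_smul_eq_smul, op_smul_eq_smul, map_smul, hPu, hPv]
  have hall : ∀ g x, P (R g *ᵥ x) = S g *ᵥ P x := by
    intro g
    have hg : g ∈ Subgroup.closure (Set.range (artin (n := n))) := by
      have := PresentedGroup.closure_range_of {w | ArtinRel n w}
      exact this.symm ▸ Subgroup.mem_top g
    induction hg using Subgroup.closure_induction with
    | mem g hg => obtain ⟨i, rfl⟩ := hg; exact hgen i
    | one => simp
    | mul g g' _ _ hg hg' =>
      intro x
      rw [map_mul, map_mul, ← Matrix.mulVec_mulVec, ← Matrix.mulVec_mulVec, hg, hg']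
    | inv g _ hg =>
      intro x
      have h1 : R g *ᵥ (R g⁻¹ *ᵥ x) = x := by
        rw [Matrix.mulVec_mulVec, ← map_mul, mul_inv_cancel, map_one, Matrix.one_mulVec]
      have h2 := hg (R g⁻¹ *ᵥ x)
      rw [h1] at h2
      rw [h2, Matrix.mulVec_mulVec, ← map_mul, inv_mul_cancel, map_one, Matrix.one_mulVec]
  exact ⟨Representation.Equiv.mk P fun g => LinearMap.ext fun x => hall g x⟩

end Classification

/-! ## The exponential `exp(c h)` in `k((h))` -/

section ExpSeries

variable {k : Type*} [Field k]

/-- The power series `exp(c h)`. -/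
def expSeries (c : k) : PowerSeries k := PowerSeries.mk fun d => c ^ d * (d.factorial : k)⁻¹

/-- The element `exp(c h)` of `k((h))`. -/
def expLaurent (c : k) : LaurentSeries k := HahnSeries.ofPowerSeries ℤ k (expSeries c)

theorem expLaurent_zero : expLaurent (0 : k) = 1 := by
  have h : expSeries (0 : k) = 1 := by
    ext d
    rw [expSeries, PowerSeries.coeff_mk, PowerSeries.coeff_one]
    split_ifs with h <;> simp [h]
  rw [expLaurent, h, map_one]

variable [CharZero k]

theorem expLaurent_add (a b : k) : expLaurent (a + b) = expLaurent a * expLaurent b := by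
  have h : ∀ c : k, expSeries c = PowerSeries.rescale c (PowerSeries.exp k) := fun c => by
    ext d
    simp [expSeries, PowerSeries.coeff_exp]
  rw [expLaurent, expLaurent, expLaurent, ← map_mul, h, h, h, PowerSeries.exp_mul_exp_eq_exp_add]

theorem expLaurent_ne_zero (c : k) : expLaurent c ≠ 0 := fun h => by
  have := expLaurent_add c (-c)
  rw [add_neg_cancel, expLaurent_zero, h, zero_mul] at this
  exact one_ne_zero this

theorem expLaurent_neg (c : k) : expLaurent (-c) = (expLaurent c)⁻¹ :=
  eq_inv_of_mul_eq_one_left (by rw [← expLaurent_add, neg_add_cancel, expLaurent_zero])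

theorem expLaurent_natCast_mul (m : ℕ) (c : k) : expLaurent (m * c) = expLaurent c ^ m := by
  induction m with
  | zero => simp [expLaurent_zero]
  | succ m ih => rw [pow_succ, ← ih, ← expLaurent_add]; congr 1; push_cast; ring

theorem expLaurent_intCast_mul (r : ℤ) (c : k) : expLaurent (r * c) = expLaurent c ^ r := by
  obtain ⟨m, rfl | rfl⟩ := r.eq_nat_or_neg
  · simpa using expLaurent_natCast_mul m c
  · rw [Int.cast_neg, Int.cast_natCast, neg_mul, expLaurent_neg, expLaurent_natCast_mul, _root_.zpow_neg,
      zpow_natCast]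

/-- The coefficient of h in exp(mch) is mc, which is nonzero in characteristic 0. -/
theorem expLaurent_pow_ne_one {c : k} (hc : c ≠ 0) {m : ℕ} (hm : m ≠ 0) :
    expLaurent c ^ m ≠ 1 := by
  intro h
  rw [← expLaurent_natCast_mul, ← expLaurent_zero, expLaurent, expLaurent] at h
  have h' := congrArg (PowerSeries.coeff 1) (HahnSeries.ofPowerSeries_injective h)
  simp [expSeries, hc, hm] at h'

/-- q + q⁻¹ = 0 would give q² = −1 and so q⁴ = 1. -/
theorem expLaurent_add_inv_ne_zero {c : k} (hc : c ≠ 0) :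
    expLaurent c + (expLaurent c)⁻¹ ≠ 0 := by
  intro h
  refine expLaurent_pow_ne_one hc (m := 4) (by norm_num) ?_
  have hq := mul_inv_cancel₀ (expLaurent_ne_zero c)
  rw [eq_neg_of_add_eq_zero_right h] at hq
  linear_combination (1 - expLaurent c ^ 2) * hq

end ExpSeries

/-! ## The Burau representation as a reflection representation -/

section BurauReflection

variable {F : Type*} [Field F] {n : ℕ}

theorem burauMat_injective {q : F} (hq : q ≠ 0) :
    Function.Injective (burauMat q : Fin (n - 1) → Matrix (Fin n) (Fin n) F) := by
  intro i j h
  -- This subdiagonal entry is q⁻¹ in the i-th matrix and 0 in all the others.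
  have h' := congrFun (congrFun h (hi i)) (lo i)
  by_contra hij
  have hij' : i.1 ≠ j.1 := fun h => hij (Fin.ext h)
  simp only [burauMat, Matrix.of_apply, lo, hi, Fin.ext_iff] at h'
  split_ifs at h' <;> first | omega | (simp_all)

/-- The 2 × 2 block has eigenvalues q and −q⁻¹, so subtracting the matrix from q leaves rank one and
trace q + q⁻¹. -/
theorem burauMat_eq (q : F) (i : Fin (n - 1)) :
    burauMat q i = q • 1 - vecMulVec (Pi.single (lo i) 1 - Pi.single (hi i) 1)
      (Pi.single (lo i) q⁻¹ - Pi.single (hi i) q) := by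
  have hne := lo_ne_hi i
  ext a b
  simp only [burauMat, Matrix.of_apply, Matrix.sub_apply, Matrix.smul_apply, Matrix.one_apply,
    vecMulVec_apply, Pi.sub_apply, Pi.single_apply]
  split_ifs <;> simp_all

theorem isReflectionRep_of_burauMat {q : F} (hq : q ≠ 0)
    {R : BraidGroup n →* Matrix (Fin n) (Fin n) F} (hR : ∀ i, R (artin i) = burauMat q i) :
    IsReflectionRep q R where
  injective i j h := burauMat_injective hq (by simpa only [hR] using h)
  rankOne i := by
    have hne := lo_ne_hi i
    refine ⟨_, _, (hR i).trans (burauMat_eq q i), ?_⟩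
    simp [dotProduct_sub, hne, hne.symm, add_comm]

theorem map_burauMat {F' : Type*} [Field F'] (f : F →+* F') (q : F) (i : Fin (n - 1)) :
    (burauMat q i).map f = burauMat (f q) i := by
  ext a b
  simp only [burauMat, Matrix.map_apply, Matrix.of_apply]
  split_ifs <;> simp

theorem substField_X {k : Type*} [Field k] [Algebra k F] (x : F) (hx : Transcendental k x) :
    substField x hx RatFunc.X = x :=
  RatFunc.algEquivOfTranscendental_X x hx

end BurauReflection

/-! ## The representations `φ̂(b ρ_bur)` as reflection representations -/

section InfBurauReflection

variable {k : Type*} [Field k] {n : ℕ}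

theorem liftNC_one_single {A G R : Type*} [Semiring A] [Monoid G] [Semiring R] (f : A →+* R)
    (g : G →* R) (a : A) :
    SkewMonoidAlgebra.liftNC (f : A →+ R) g (SkewMonoidAlgebra.single 1 a) = f a := by
  rw [SkewMonoidAlgebra.liftNC_single, map_one, mul_one]
  rfl

theorem liftNC_single_one {A G R : Type*} [Semiring A] [Monoid G] [Semiring R] (f : A →+* R)
    (g : G →* R) (s : G) :
    SkewMonoidAlgebra.liftNC (f : A →+ R) g (SkewMonoidAlgebra.single s 1) = g s := by
  rw [SkewMonoidAlgebra.liftNC_single]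
  exact (congrArg (· * _) (map_one f)).trans (one_mul _)

theorem infBurau_one_single (a : ChordAlg k n) : infBurau k n (SkewMonoidAlgebra.single 1 a) =
    liftChord (infBurauChord k) (isChordFamily_infBurau k) a :=
  liftNC_one_single _ _ a

theorem infBurau_single_one (s : Equiv.Perm (Fin n)) :
    infBurau k n (SkewMonoidAlgebra.single s 1) = permRep k n s :=
  liftNC_single_one _ _ s

theorem scaleRep_single_one_chord (b : k) (i j : Fin n) :
    scaleRep b (infBurau k n) (SkewMonoidAlgebra.single 1 (chord k i j)) =
      b • infBurauChord k i j := by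
  have h1 : scaleAlg n b (SkewMonoidAlgebra.single 1 (chord k i j)) =
      SkewMonoidAlgebra.single 1 (b • chord k i j) :=
    (liftNC_one_single _ _ _).trans (liftChord_chord _ _ i j)
  rw [scaleRep, AlgHom.comp_apply, h1, infBurau_one_single, map_smul, liftChord_chord]

theorem scaleRep_single_one (b : k) (s : Equiv.Perm (Fin n)) :
    scaleRep b (infBurau k n) (SkewMonoidAlgebra.single s 1) = permRep k n s := by
  have h1 : scaleAlg n b (SkewMonoidAlgebra.single s 1) = SkewMonoidAlgebra.single s 1 :=
    liftNC_single_one _ _ s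
  rw [scaleRep, AlgHom.comp_apply, h1, infBurau_single_one]

theorem infBraidAlg_hom_ext {E : Type*} [Semiring E] [Algebra k E] {f g : InfBraidAlg k n →ₐ[k] E}
    (hc : ∀ i j, f (SkewMonoidAlgebra.single 1 (chord k i j)) =
      g (SkewMonoidAlgebra.single 1 (chord k i j)))
    (hs : ∀ s, f (SkewMonoidAlgebra.single s 1) = g (SkewMonoidAlgebra.single s 1)) : f = g := by
  have h : f.comp (inclAlg k _ _) = g.comp (inclAlg k _ _) := chordAlg_hom_ext hc
  refine AlgHom.ext fun x => ?_
  induction x using SkewMonoidAlgebra.induction_on with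
  | zero => rw [map_zero, map_zero]
  | single s a =>
    have e : (SkewMonoidAlgebra.single s a : InfBraidAlg k n) =
        SkewMonoidAlgebra.single 1 a * SkewMonoidAlgebra.single s 1 := by
      simp [SkewMonoidAlgebra.single_mul_single]
    rw [e, map_mul, map_mul, hs]
    exact congrArg (· * _) (DFunLike.congr_fun h a)
  | add x y hx hy => rw [map_add, map_add, hx, hy]

theorem scaleRep_one_infBurau : scaleRep 1 (infBurau k n) = infBurau k n := by
  refine infBraidAlg_hom_ext (fun i j => ?_) fun s => ?_
  · rw [scaleRep_single_one_chord, one_smul, infBurau_one_single, liftChord_chord]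
  · rw [scaleRep_single_one, infBurau_single_one]

theorem component_compChord_pow (m d : ℕ) (i j : Fin n) :
    component d (compChord k i j ^ m) = if d = m then chord k i j ^ m else 0 := by
  have h : ((compChord k i j ^ m : CompChordAlg k n) : PowerSeries (ChordAlg k n)) =
      PowerSeries.monomial m (chord k i j ^ m) := by
    induction m with
    | zero => simp [PowerSeries.monomial_zero_eq_C_apply]
    | succ m ih =>
      rw [pow_succ, Subalgebra.coe_mul, ih, compChord, PowerSeries.monomial_mul_monomial, pow_succ]
  rw [component, h, PowerSeries.coeff_monomial]

theorem component_compExp_smul_compChord (c : k) (d : ℕ) (i j : Fin n) :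
    component d (compExp (c • compChord k i j)) =
      (c ^ d * (d.factorial : k)⁻¹) • chord k i j ^ d := by
  rw [compExp, component_ofComp, Finset.sum_eq_single d]
  · rw [smul_pow, component_const_smul, component_compChord_pow, if_pos rfl, smul_smul, mul_comm]
  · intro m _ hm
    rw [smul_pow, component_const_smul, component_compChord_pow, if_neg (Ne.symm hm), smul_zero,
      smul_zero]
  · simp

/-- In degree 0 the truncated exponential sum keeps only the term m = 0. This is all that will be
needed about ψ_i modulo h. -/
theorem component_zero_compExp (x : CompChordAlg k n) : component 0 (compExp x) = 1 := by
  simp [compExp, component_one]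

/-- The matrix of power series whose image in `k((h))` is `tildeChord ρ f`. -/
def tildeChordPS {ι : Type*} [Fintype ι] [DecidableEq ι] (ρ : InfBraidAlg k n →ₐ[k] Matrix ι ι k)
    (f : CompChordAlg k n) : Matrix ι ι (PowerSeries k) :=
  Matrix.of fun a b =>
    PowerSeries.mk fun d => ρ (SkewMonoidAlgebra.single 1 (component d f)) a b

theorem mapMatrix_tildeChordPS {ι : Type*} [Fintype ι] [DecidableEq ι]
    (ρ : InfBraidAlg k n →ₐ[k] Matrix ι ι k) (f : CompChordAlg k n) :
    (HahnSeries.ofPowerSeries ℤ k).mapMatrix (tildeChordPS ρ f) = tildeChord ρ f := rfl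

theorem constantCoeff_tildeChordPS_compExp {ι : Type*} [Fintype ι] [DecidableEq ι]
    (ρ : InfBraidAlg k n →ₐ[k] Matrix ι ι k) (x : CompChordAlg k n) :
    PowerSeries.constantCoeff.mapMatrix (tildeChordPS ρ (compExp x)) = 1 := by
  ext a b
  rw [RingHom.mapMatrix_apply, Matrix.map_apply, tildeChordPS, Matrix.of_apply,
    ← PowerSeries.coeff_zero_eq_constantCoeff_apply, PowerSeries.coeff_mk, component_zero_compExp,
    SkewMonoidAlgebra.single_one_one, map_one]

theorem tilde_single_one {ι : Type*} [Fintype ι] [DecidableEq ι]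
    (ρ : InfBraidAlg k n →ₐ[k] Matrix ι ι k) (f : CompChordAlg k n) :
    tilde ρ (SkewMonoidAlgebra.single 1 f) = tildeChord ρ f :=
  liftNC_one_single _ _ f

theorem tilde_single {ι : Type*} [Fintype ι] [DecidableEq ι]
    (ρ : InfBraidAlg k n →ₐ[k] Matrix ι ι k) (s : Equiv.Perm (Fin n)) :
    tilde ρ (SkewMonoidAlgebra.single s 1) =
      HahnSeries.C.mapMatrix (ρ (SkewMonoidAlgebra.single s 1)) :=
  liftNC_single_one _ _ s

theorem permRep_injective : Function.Injective (permRep k n) := by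
  intro s t h
  refine Equiv.ext fun b => ?_
  have h' := congrFun (congrFun h (s b)) b
  by_contra hne
  change (if s b = s b then (1 : k) else 0) = if s b = t b then 1 else 0 at h'
  simp [hne] at h'

theorem adjSwap_injective : Function.Injective (adjSwap : Fin (n - 1) → _) := by
  intro i j h
  have h' := congrArg (fun s : Equiv.Perm (Fin n) => s (lo i)) h
  simp only [adjSwap, Equiv.swap_apply_left] at h'
  rw [Equiv.swap_apply_def] at h'
  split_ifs at h' with h1 h2
  · exact Fin.ext (by simpa [lo] using h1)
  · simp only [lo, hi, Fin.ext_iff] at h' h2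
    omega
  · exact absurd h'.symm (lo_ne_hi i)

/-- A transposition is the reflection that negates e_i − e_j, a vector whose square is 2. -/
theorem permRep_swap_eq {i j : Fin n} (h : i ≠ j) :
    permRep k n (Equiv.swap i j) = 1 - vecMulVec (Pi.single i 1 - Pi.single j 1)
      (Pi.single i 1 - Pi.single j 1) := by
  ext a b
  change (if a = Equiv.swap i j b then (1 : k) else 0) = _
  rw [Equiv.swap_apply_def]
  simp only [Matrix.sub_apply, Matrix.one_apply, vecMulVec_apply, Pi.sub_apply, Pi.single_apply]
  split_ifs <;> simp_all

/-- A power series matrix with constant term 1 is invertible over k[[h]], so conjugating by it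
preserves integrality and does not change the reduction modulo h. -/
theorem mapMatrix_constantCoeff_conj {ι : Type*} [Fintype ι] [DecidableEq ι]
    {X Z : Matrix ι ι (PowerSeries k)} (hX : PowerSeries.constantCoeff.mapMatrix X = 1)
    {M : Matrix ι ι (LaurentSeries k)}
    (hM : M * (HahnSeries.ofPowerSeries ℤ k).mapMatrix X =
      (HahnSeries.ofPowerSeries ℤ k).mapMatrix X * (HahnSeries.ofPowerSeries ℤ k).mapMatrix Z) :
    ∃ Y : Matrix ι ι (PowerSeries k), M = (HahnSeries.ofPowerSeries ℤ k).mapMatrix Y ∧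
      PowerSeries.constantCoeff.mapMatrix Y = PowerSeries.constantCoeff.mapMatrix Z := by
  have hu : IsUnit X := by
    rw [Matrix.isUnit_iff_isUnit_det, PowerSeries.isUnit_iff_constantCoeff, RingHom.map_det, hX,
      Matrix.det_one]
    exact isUnit_one
  obtain ⟨u, rfl⟩ := hu
  refine ⟨u * Z * (↑u⁻¹ : Matrix ι ι (PowerSeries k)), ?_, ?_⟩
  · rw [map_mul, map_mul, ← hM, mul_assoc, ← map_mul, Units.mul_inv, map_one, mul_one]
  · have h1 : PowerSeries.constantCoeff.mapMatrix (↑u⁻¹ : Matrix ι ι (PowerSeries k)) = 1 := by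
      have h := congrArg PowerSeries.constantCoeff.mapMatrix u.mul_inv
      rwa [map_mul, hX, one_mul, map_one] at h
    rw [map_mul, map_mul, hX, h1, one_mul, mul_one]

/-- The morphism `B_n → M_n(k((h)))` underlying `φ̂(b ρ_bur)`. -/
def hatInfBurau (φ : MonoidAlgebra k (BraidGroup n) →ₐ[k] CompInfBraidAlg k n) (b : k) :
    BraidGroup n →* Matrix (Fin n) (Fin n) (LaurentSeries k) :=
  ((tilde (scaleRep b (infBurau k n))).comp φ.toRingHom).toMonoidHom.comp
    (MonoidAlgebra.of k (BraidGroup n))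

/-- Modulo h both ψ_i and exp(t_{i,i+1}/2) become 1, so only s_i survives. This is what separates
the images of the Artin generators. -/
theorem PropertyStar.exists_constantCoeff
    {φ : MonoidAlgebra k (BraidGroup n) →ₐ[k] CompInfBraidAlg k n} (hφ : PropertyStar φ) (b : k)
    (i : Fin (n - 1)) : ∃ Y : Matrix (Fin n) (Fin n) (PowerSeries k),
      hatInfBurau φ b (artin i) = (HahnSeries.ofPowerSeries ℤ k).mapMatrix Y ∧
      PowerSeries.constantCoeff.mapMatrix Y = permRep k n (adjSwap i) := by
  obtain ⟨x, _, ψ, hψ, h⟩ := hφ i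
  set ρ := scaleRep b (infBurau k n)
  set E := compExp ((1 / 2 : k) • compChord k (lo i) (hi i)) with hE
  set Z : Matrix (Fin n) (Fin n) (PowerSeries k) :=
    PowerSeries.C.mapMatrix (permRep k n (adjSwap i)) * tildeChordPS ρ E
  have hZ : (HahnSeries.ofPowerSeries ℤ k).mapMatrix Z = tilde ρ (elemR k i) := by
    rw [elemR, map_mul, map_mul, tilde_single, tilde_single_one, ← mapMatrix_tildeChordPS,
      scaleRep_single_one]
    congr 1
    ext1 a c
    exact HahnSeries.ofPowerSeries_C _
  -- Writing the conjugation as Mψ = ψR avoids the inverse of ψ, which is not given as an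
  -- exponential.
  have hM : hatInfBurau φ b (artin i) * tilde ρ (ψ : CompInfBraidAlg k n) =
      tilde ρ (ψ : CompInfBraidAlg k n) * tilde ρ (elemR k i) := by
    change tilde ρ (φ (MonoidAlgebra.of k (BraidGroup n) (artin i))) * _ = _
    rw [h, ← map_mul, ← map_mul, mul_assoc, Units.inv_mul, mul_one]
  rw [hψ, tilde_single_one, ← mapMatrix_tildeChordPS, ← hZ] at hM
  obtain ⟨Y, hY, hY'⟩ :=
    mapMatrix_constantCoeff_conj (constantCoeff_tildeChordPS_compExp ρ x) hM
  refine ⟨Y, hY, hY'.trans ?_⟩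
  rw [map_mul, constantCoeff_tildeChordPS_compExp, mul_one]
  ext1 a c
  exact PowerSeries.constantCoeff_C _

variable [CharZero k]

/-- The chord acts as bh times an involution P, and exp((bh/2)P) = cosh(bh/2) + sinh(bh/2) P. -/
theorem tildeChord_compExp (b : k) {i j : Fin n} (hij : i ≠ j) :
    tildeChord (scaleRep b (infBurau k n)) (compExp ((1 / 2 : k) • compChord k i j)) =
      ((expLaurent (b / 2) + expLaurent (-(b / 2))) / 2) • 1 +
      ((expLaurent (b / 2) - expLaurent (-(b / 2))) / 2) •
        HahnSeries.C.mapMatrix (permRep k n (Equiv.swap i j)) := by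
  have hρ : ∀ d, scaleRep b (infBurau k n) (SkewMonoidAlgebra.single 1
      (component d (compExp ((1 / 2 : k) • compChord k i j)))) =
      ((b / 2) ^ d * (d.factorial : k)⁻¹) • permRep k n (Equiv.swap i j) ^ d := by
    intro d
    have h := map_pow ((scaleRep b (infBurau k n)).comp
      (inclAlg k (ChordAlg k n) (Equiv.Perm (Fin n)))) (chord k i j) d
    have h' := map_smul ((scaleRep b (infBurau k n)).comp
      (inclAlg k (ChordAlg k n) (Equiv.Perm (Fin n))))
        ((1 / 2 : k) ^ d * (d.factorial : k)⁻¹) (chord k i j ^ d)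
    rw [h] at h'
    rw [component_compExp_smul_compChord]
    refine h'.trans ?_
    have e : (scaleRep b (infBurau k n)).comp
        (inclAlg k (ChordAlg k n) (Equiv.Perm (Fin n))) (chord k i j) =
        b • permRep k n (Equiv.swap i j) := by
      refine (scaleRep_single_one_chord b i j).trans ?_
      rw [infBurauChord, if_neg hij]
    rw [e, smul_pow, smul_smul]
    congr 1
    rw [div_pow, div_pow, one_pow]
    ring
  have hsq : permRep k n (Equiv.swap i j) * permRep k n (Equiv.swap i j) = 1 := by
    rw [← map_mul, Equiv.swap_mul_self, map_one]
  ext1 a c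
  have hC : ∀ c : k, (HahnSeries.C c : LaurentSeries k) =
      HahnSeries.ofPowerSeries ℤ k (PowerSeries.C c) := fun c =>
    (HahnSeries.ofPowerSeries_C c).symm
  have h2 : (2 : LaurentSeries k)⁻¹ = HahnSeries.ofPowerSeries ℤ k (PowerSeries.C (1 / 2 : k)) := by
    rw [← hC, inv_eq_one_div, map_div₀, map_one, map_ofNat]
  have h1 : (1 : Matrix (Fin n) (Fin n) (LaurentSeries k)) =
      HahnSeries.C.mapMatrix (1 : Matrix (Fin n) (Fin n) k) := (map_one _).symm
  rw [h1]
  change HahnSeries.ofPowerSeries ℤ k (PowerSeries.mk fun d => _) = _ * HahnSeries.C _ +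
    _ * HahnSeries.C _
  simp only [div_eq_mul_inv _ (2 : LaurentSeries k), h2, hC, expLaurent]
  simp only [← map_mul, ← map_add, ← map_sub]
  refine congrArg (HahnSeries.ofPowerSeries ℤ k) (PowerSeries.ext fun d => ?_)
  simp only [PowerSeries.coeff_mk, map_add, map_sub, PowerSeries.coeff_mul_C, expSeries, hρ,
    Matrix.smul_apply, smul_eq_mul]
  -- P^d is 1 for even d and P for odd d, which separates the cosh and sinh parts.
  rcases Nat.even_or_odd' d with ⟨e, rfl | rfl⟩
  · rw [pow_mul (permRep k n (Equiv.swap i j)), pow_two (permRep k n (Equiv.swap i j)), hsq,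
      one_pow, (even_two_mul e).neg_pow]
    ring
  · rw [pow_succ (permRep k n (Equiv.swap i j)), pow_mul (permRep k n (Equiv.swap i j)),
      pow_two (permRep k n (Equiv.swap i j)), hsq, one_pow, one_mul,
      (odd_two_mul_add_one e).neg_pow]
    ring

theorem half_add_smul_one_sub {F A : Type*} [Field F] [Ring A] [Algebra F A]
    (h : (2 : F) ≠ 0) (p q : F) (e : A) :
    ((q + p) / 2) • (1 - e) + ((q - p) / 2) • 1 = q • 1 - ((q + p) / 2) • e := by
  have h' : (q - p) / 2 = q - (q + p) / 2 := by
    field_simp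
    ring
  rw [h']
  module

theorem two_ne_zero_laurentSeries (k : Type*) [Field k] [CharZero k] :
    (2 : LaurentSeries k) ≠ 0 := by
  rw [← map_ofNat (HahnSeries.C : k →+* LaurentSeries k), map_ne_zero]
  exact two_ne_zero

/-- Multiplying cosh + sinh·P by P exchanges the two coefficients, and P = 1 − wwᵀ with w = e_i −
e_{i+1}. The result is (cosh + sinh) − cosh·wwᵀ, where cosh + sinh = exp(bh/2). -/
theorem tilde_elemR (b : k) (i : Fin (n - 1)) :
    tilde (scaleRep b (infBurau k n)) (elemR k i) = expLaurent (b / 2) • 1 -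
      vecMulVec (Pi.single (lo i) 1 - Pi.single (hi i) 1)
        (((expLaurent (b / 2) + (expLaurent (b / 2))⁻¹) / 2) •
          (Pi.single (lo i) 1 - Pi.single (hi i) 1)) := by
  have hne := lo_ne_hi i
  have hP : HahnSeries.C.mapMatrix (permRep k n (Equiv.swap (lo i) (hi i))) =
      (1 : Matrix (Fin n) (Fin n) (LaurentSeries k)) -
        vecMulVec (Pi.single (lo i) 1 - Pi.single (hi i) 1)
          (Pi.single (lo i) 1 - Pi.single (hi i) 1) := by
    rw [← permRep_swap_eq hne]
    ext1 a c
    change HahnSeries.C (if a = Equiv.swap (lo i) (hi i) c then (1 : k) else 0) =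
      if a = Equiv.swap (lo i) (hi i) c then (1 : LaurentSeries k) else 0
    split_ifs <;> simp
  have hsq : HahnSeries.C.mapMatrix (permRep k n (Equiv.swap (lo i) (hi i))) *
      HahnSeries.C.mapMatrix (permRep k n (Equiv.swap (lo i) (hi i))) =
      (1 : Matrix (Fin n) (Fin n) (LaurentSeries k)) := by
    rw [← map_mul, ← map_mul, Equiv.swap_mul_self, map_one, map_one]
  rw [elemR, map_mul, tilde_single, tilde_single_one, tildeChord_compExp b hne,
    scaleRep_single_one, adjSwap, mul_add, mul_smul_comm, mul_smul_comm, hsq, hP, mul_one,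
    expLaurent_neg, vecMulVec_smul, half_add_smul_one_sub (two_ne_zero_laurentSeries k)]

theorem PropertyStar.isReflectionRep
    {φ : MonoidAlgebra k (BraidGroup n) →ₐ[k] CompInfBraidAlg k n} (hφ : PropertyStar φ) (b : k) :
    IsReflectionRep (expLaurent (b / 2)) (hatInfBurau φ b) where
  injective i j h := by
    obtain ⟨Y, hY, hYi⟩ := hφ.exists_constantCoeff b i
    obtain ⟨Y', hY', hYj⟩ := hφ.exists_constantCoeff b j
    have hYY : Y = Y' := Matrix.map_injective HahnSeries.ofPowerSeries_injective
      (hY.symm.trans (h.trans hY'))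
    exact adjSwap_injective (permRep_injective (k := k) (by rw [← hYi, hYY, hYj]))
  rankOne i := by
    obtain ⟨x, _, ψ, _, h⟩ := hφ i
    have hne := lo_ne_hi i
    have hA : hatInfBurau φ b (artin i) = tilde (scaleRep b (infBurau k n)) ψ *
        tilde (scaleRep b (infBurau k n)) (elemR k i) *
        tilde (scaleRep b (infBurau k n)) (↑ψ⁻¹ : CompInfBraidAlg k n) := by
      change tilde _ (φ (MonoidAlgebra.of k (BraidGroup n) (artin i))) = _
      rw [h, map_mul, map_mul]
    have hinv : tilde (scaleRep b (infBurau k n)) ψ *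
        tilde (scaleRep b (infBurau k n)) (↑ψ⁻¹ : CompInfBraidAlg k n) = 1 := by
      rw [← map_mul, Units.mul_inv, map_one]
    have hinv' : tilde (scaleRep b (infBurau k n)) (↑ψ⁻¹ : CompInfBraidAlg k n) *
        tilde (scaleRep b (infBurau k n)) ψ = 1 := by
      rw [← map_mul, Units.inv_mul, map_one]
    rw [tilde_elemR, mul_sub, sub_mul, mul_smul_comm, mul_one, smul_mul_assoc, hinv, mul_vecMulVec,
      vecMulVec_mul] at hA
    refine ⟨_, _, hA, ?_⟩
    -- The conjugated vectors are ψu and vψ⁻¹, so their pairing is still v·u = cosh·(w·w) = 2cosh =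
    -- q + q⁻¹.
    rw [dotProduct_mulVec, vecMul_vecMul, hinv', vecMul_one]
    have h2 := two_ne_zero_laurentSeries k
    simp only [smul_dotProduct, dotProduct_sub, sub_dotProduct, single_dotProduct, smul_eq_mul,
      Pi.single_eq_same, Pi.single_eq_of_ne hne, Pi.single_eq_of_ne hne.symm]
    field_simp
    ring

/-- For every `b ≠ 0`, the representation `φ̂(b ρ_bur)` is isomorphic to any representation in
which the Artin generators act by the Burau matrices at `q = exp(b h / 2)`. -/
theorem PropertyStar.nonempty_equiv
    {φ : MonoidAlgebra k (BraidGroup n) →ₐ[k] CompInfBraidAlg k n} (hφ : PropertyStar φ) {b : k}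
    (hb : b ≠ 0) {R : BraidGroup n →* Matrix (Fin n) (Fin n) (LaurentSeries k)}
    (hR : ∀ i, R (artin i) = burauMat (expLaurent (b / 2)) i) :
    Nonempty (Representation.Equiv (hatRep φ (scaleRep b (infBurau k n))) (matRep R)) := by
  have hb' : b / 2 ≠ 0 := div_ne_zero hb two_ne_zero
  exact (hφ.isReflectionRep b).nonempty_equiv
    (isReflectionRep_of_burauMat (expLaurent_ne_zero _) hR) (expLaurent_ne_zero _)
    (expLaurent_add_inv_ne_zero hb') (expLaurent_pow_ne_one hb' (by simp))

end InfBurauReflection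

theorem burau_artin (k : Type*) [Field k] {n : ℕ} (i : Fin (n - 1)) :
    (burau k n (artin i) : Matrix (Fin n) (Fin n) (RatFunc k)) = burauMat RatFunc.X i := by
  rw [burau, artin, PresentedGroup.toGroup.of]
  rfl

end InfBraid

end

theorem mainTheorem6 {k : Type*} [Field k] [CharZero k] (n : ℕ) (hn : 2 ≤ n)
    (φ : MonoidAlgebra k (InfBraid.BraidGroup n) →ₐ[k] InfBraid.CompInfBraidAlg k n)
    (hφ : InfBraid.PropertyStar φ) :
    Nonempty (Representation.Equiv
      (InfBraid.hatRep φ (InfBraid.infBurau k n))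
      (InfBraid.extendRep (InfBraid.burau k n))) ∧
    ∀ (r : ℤ) (hr : r ≠ 0), Nonempty (Representation.Equiv
      (InfBraid.hatRep φ (InfBraid.scaleRep (r : k) (InfBraid.infBurau k n)))
      (InfBraid.extendRep (InfBraid.twist hr (InfBraid.burau k n)))) := by
  have hX : InfBraid.embField k RatFunc.X = InfBraid.expLaurent (1 / 2 : k) :=
    InfBraid.substField_X _ _
  constructor
  · have h := hφ.nonempty_equiv one_ne_zero
      (R := (Units.coeHom _).comp ((Matrix.GeneralLinearGroup.map (InfBraid.embField k)).comp
        (InfBraid.burau k n))) fun i => by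
        rw [← hX, ← InfBraid.map_burauMat, ← InfBraid.burau_artin]
        rfl
    rwa [InfBraid.scaleRep_one_infBurau] at h
  · intro r hr
    refine hφ.nonempty_equiv (Int.cast_ne_zero.mpr hr) fun i => ?_
    -- The twist followed by the embedding sends q to q^r and then to exp(h/2)^r = exp(rh/2), the
    -- parameter belonging to b = r.
    have hr' : InfBraid.expLaurent ((r : k) / 2) =
        InfBraid.embField k (InfBraid.twistField k hr RatFunc.X) := by
      rw [InfBraid.twistField, InfBraid.substField_X, map_zpow₀, hX,
        ← InfBraid.expLaurent_intCast_mul, mul_one_div]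
    rw [hr', ← InfBraid.map_burauMat, ← InfBraid.map_burauMat, ← InfBraid.burau_artin]
    rfl
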